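/- **Setting.** Let $G=(V,E)$ be a finite directed graph with edge lengths $\ell(e)\ge 0$ (undirected graphs are the symmetric case). Let $\mathcal I$ assign to each $v\in V$ a finite set $\mathcal I(v)$ of closed intervals $[t_s,t_e]\subseteq[0,1]$, any two different ones of the same vertex sharing at most one point; $|I|$ is the length of an interval. Let $v_0\in V$. For a path $\pi=\langle v_0,\dots,v_k\rangle$ (vertices may repeat; $k=0$ is allowed) put $\ell_\pi(v_i)=\sum_{j<i}\ell(v_j,v_{j+1})$, $\ell^-(v_i)=\ell_\pi(v_i)-\tfrac12\ell(v_{i-1},v_i)$, $\ell^+(v_i)=\ell_\pi(v_i)+\tfrac12\ell(v_i,v_{i+1})$, where the non-existing edges before $v_0$ and after $v_k$ have length $0$. Put $\ell^+(v_i,v_j)=\ell^+(v_j)-\ell^+(v_i)$ and $\ell^+(v_{-1},v_0)=\ell^+(v_0)$. A *timing profile* is $\mathcal T=\langle t_0,\dots,t_{k-1}\rangle$ with $t_0\ge\ell^+(v_0)$, $t_{i+1}\ge t_i+\ell^+(v_i,v_{i+1})$ and $t_{k-1}+\ell^+(v_{k-1},v_k)\le 1$ (no condition if $k=0$). With $\mathcal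 R(u,t,t')=\sum_{I\in\mathcal I(u)}|[t,t']\cap I|$, $t_{-1}=0$ and $t_k=1$, its reward is $\mathcal R(\pi,\mathcal T)=\sum_{i=0}^k\mathcal R(v_i,t_{i-1},t_i)$. The *OPTP problem* asks for the maximum of $\mathcal R(\pi,\mathcal T)$ over all paths $\pi$ from $v_0$ and all timing profiles $\mathcal T$ of $\pi$. **Critical times.** By convention position $0$ of $\pi$ additionally carries the interval $[\ell^+(v_0),\ell^+(v_0)]$ and position $k$ the interval $[1-\ell^+(v_{k-1},v_k),\,1-\ell^+(v_{k-1},v_k)]$. For $i<j$ let $CT(v_i,v_j)$ consist of all $t_e$ with $[t_s,t_e]$ an interval at position $i$ and all $t_s-(\ell^-(v_j)-\ell^+(v_i))$ with $[t_s,t_e]$ an interval at position $j$. Let $CT_m=\bigcup_{i<j}\{t+\ell^+(v_i,v_m): t\in CT(v_i,v_j)\}$ if $k\ge1$, and $CT_0=\{1\}$ if $k=0$. **OTP algorithm on $\pi$.** Start with the list of (entry time, reward) pairs $\{(0,0)\}$. For $i=0,\dots,k$: set $R_{\max}\leftarrow0$ and start an empty exit list; for every $t\in CT_i\cap[0,1]$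 in increasing order let $r$ be the maximum of $r'+\mathcal R(v_i,t',t)$ over the entry pairs $(t',r')$ with $t'+\ell^+(v_{i-1},v_i)\le t$ (skip $t$ if there is none), and if the exit list is empty or $r>R_{\max}$, set $R_{\max}\leftarrow r$ and append $(t,r)$ to the exit list; then the exit list becomes the entry list for $i+1$. Return the last $R_{\max}$, denoted $\mathrm{OTP}(\pi)$. **Upper bounds.** Let $\delta'(u,v)=\inf(\ell^-(v)-\ell^+(u))$ over all paths from $u$ to $v$ (evaluated at the end points of the path), $\infty$ if there is none. Let $N$ be the number of all pairs (vertex, interval of that vertex). For an interval $I=[t_s,t_e]$ of $u$ set $ub^0_I=|I|$, and let $ub^{n+1}_I$ be the maximum of $ub^n_I$ and of all $|I|+ub^n_{I'}-\max\{0,t_e+\delta'(u,v)-t'_s\}$ over the intervals $I'=[t'_s,t'_e]$ of vertices $v$ that are reachable from $I$, i.e. $t_s+\delta'(u,v)\le t'_e$; put $ub_I=ub^N_I$. Let $ub(u,t)$ be the maximum of $0$ and of all $ub_I-\max\{0,t+\delta'(u,v)-t_s\}$ over the intervals $I=[t_s,t_e]$ of vertices $v$ with $\delta'(u,v)<\infty$.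 Let $ub(\pi)$ be the maximum of $0$ and of all $r+ub(v_k,t_s+\ell^+(v_i,v_k))$ over $0\le i\le k$ and all intervals $[t_s,t_e]$ at position $i$ (including the two conventional ones), where $r$ is the best reward for leaving $v_i$ at time $t_e$ in the run of the OTP algorithm on $\pi$ with the test $t'+\ell^+(v_{i-1},v_i)\le t$ replaced everywhere by $t'\le t$; intervals for which no entry pair passes the test are skipped. **Branch and bound.** $\mathrm{BB}(\pi,R_{\max})$, for $\pi=\langle v_0,\dots,v_k\rangle$: if $\ell^+(v_k)>1$, return $0$. Set $R_{\max}\leftarrow\max\{R_{\max},\mathrm{OTP}(\pi)\}$. If $ub(\pi)\le R_{\max}$, return $R_{\max}$. Otherwise, for each $w$ with $(v_k,w)\in E$ (in any fixed order), set $R_{\max}\leftarrow\max\{R_{\max},\mathrm{BB}(\langle v_0,\dots,v_k,w\rangle,R_{\max})\}$. Return $R_{\max}$. **Theorem.** For every such $G$, $\mathcal I$, $v_0$ and every order of the out-neighbours: 1. whenever $\mathrm{BB}(\langle v_0\rangle,0)$ returns a value $R$, the maximum in the OPTP problem is attained and equals $R$; 2. if every closed path of $G$ with at least one edge has positive length,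 then $\mathrm{BB}(\langle v_0\rangle,0)$ terminates. Hence, in the absence of cycles of length zero, the branch-and-bound algorithm solves the OPTP problem. -/

import Mathlib

namespace GTAP

/-- A (directed) task-assistance graph on the vertex set `V`: an edge relation and a non-negative
length (equivalently, traversal time) for every edge. An undirected graph is the symmetric case.
The value of `len` at a pair that is not an edge is never used. -/
structure TaskGraph (V : Type*) where
  Adj : V → V → Prop
  len : V → V → ℝ
  len_nonneg : ∀ u v, Adj u v → 0 ≤ len u v

/-- An interval mapping: each vertex `v` carries a finite set of closed time intervals
`[s, e] ⊆ [0, 1]`, stored as pairs `(s, e)`. Two different intervals of the same vertex overlap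
in at most one point (they may be adjacent). -/
structure IntervalMap (V : Type*) where
  ivl : V → Finset (ℝ × ℝ)
  mem_unit : ∀ v, ∀ J ∈ ivl v, 0 ≤ J.1 ∧ J.1 ≤ J.2 ∧ J.2 ≤ 1
  nonoverlap : ∀ v, ∀ J ∈ ivl v, ∀ K ∈ ivl v, J ≠ K → min J.2 K.2 ≤ max J.1 K.1

/-- A vertex sequence `⟨v_0, …, v_k⟩` with `k = last`; the values of `vert` beyond `last` are
irrelevant. Vertices may repeat. -/
structure VSeq (V : Type*) where
  last : ℕ
  vert : ℕ → V

namespace VSeq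

variable {V : Type*}

/-- The one-vertex sequence `⟨v⟩`. -/
def single (v : V) : VSeq V := ⟨0, fun _ => v⟩

/-- `⟨v_0, …, v_k⟩ ↦ ⟨v_0, …, v_k, w⟩`. -/
def extend (p : VSeq V) (w : V) : VSeq V :=
  ⟨p.last + 1, fun i => if i ≤ p.last then p.vert i else w⟩

/-- The last vertex `v_k`. -/
def endpoint (p : VSeq V) : V := p.vert p.last

end VSeq

noncomputable section

variable {V : Type*}

/-! ### Paths, timing profiles, rewards, and the optimization problem -/

/-- The sequence is a path of the graph: consecutive vertices are joined by edges. -/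
def IsPath (G : TaskGraph V) (p : VSeq V) : Prop :=
  ∀ i < p.last, G.Adj (p.vert i) (p.vert (i + 1))

/-- `ℓ(v_i)`: length of the path from `v_0` to `v_i`. -/
def lenTo (G : TaskGraph V) (p : VSeq V) (i : ℕ) : ℝ :=
  ∑ j ∈ Finset.range i, G.len (p.vert j) (p.vert (j + 1))

/-- `ℓ⁻(v_i)`: length of the path from `v_0` to the middle of the incoming edge of `v_i`
(the incoming edge of `v_0` counts as having length `0`). -/
def lenMinus (G : TaskGraph V) (p : VSeq V) (i : ℕ) : ℝ :=
  lenTo G p i - if 0 < i then G.len (p.vert (i - 1)) (p.vert i) / 2 else 0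

/-- `ℓ⁺(v_i)`: length of the path from `v_0` to the middle of the outgoing edge of `v_i`
(the outgoing edge of `v_k` counts as having length `0`). -/
def lenPlus (G : TaskGraph V) (p : VSeq V) (i : ℕ) : ℝ :=
  lenTo G p i + if i < p.last then G.len (p.vert i) (p.vert (i + 1)) / 2 else 0

/-- `ℓ⁺(v_i, v_j) = ℓ⁺(v_j) - ℓ⁺(v_i)`. -/
def lenBetween (G : TaskGraph V) (p : VSeq V) (i j : ℕ) : ℝ :=
  lenPlus G p j - lenPlus G p i

/-- `ℓ⁺(v_{i-1}, v_i)`, which for `i = 0` is `ℓ⁺(v_0)`: the minimal time between the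
moments at which `v_{i-1}` and `v_i` are left (the path starts at time `0`). -/
def step (G : TaskGraph V) (p : VSeq V) (i : ℕ) : ℝ :=
  if i = 0 then lenPlus G p 0 else lenBetween G p (i - 1) i

/-- `⟨t_0, …, t_{k-1}⟩` is a timing profile of `⟨v_0, …, v_k⟩`; `t_i` is the time at which the
middle of the edge from `v_i` to `v_{i+1}` is reached. Values `t i` with `i ≥ k` are irrelevant. -/
structure IsTimingProfile (G : TaskGraph V) (p : VSeq V) (t : ℕ → ℝ) : Prop where
  first : 0 < p.last → lenPlus G p 0 ≤ t 0
  next : ∀ i, i + 1 < p.last → t i + lenBetween G p i (i + 1) ≤ t (i + 1)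
  final : 0 < p.last → t (p.last - 1) + lenBetween G p (p.last - 1) p.last ≤ 1

/-- `R(u, t, t')`, the sum over the intervals `[s, e]` of `u` of the length of
`[t, t'] ∩ [s, e]`. -/
def vertexReward (I : IntervalMap V) (u : V) (t t' : ℝ) : ℝ :=
  ∑ J ∈ I.ivl u, max 0 (min t' J.2 - max t J.1)

/-- `R(π, T) = ∑_{i=0}^k R(v_i, t_{i-1}, t_i)` with `t_{-1} = 0` and `t_k = 1`. -/
def profileReward (I : IntervalMap V) (p : VSeq V) (t : ℕ → ℝ) : ℝ :=
  ∑ i ∈ Finset.range (p.last + 1),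
    vertexReward I (p.vert i) (if i = 0 then 0 else t (i - 1)) (if i = p.last then 1 else t i)

/-- The set of rewards of all feasible solutions of the OPTP problem with start vertex `v₀`. -/
def optpRewards (G : TaskGraph V) (I : IntervalMap V) (v₀ : V) : Set ℝ :=
  {r | ∃ (p : VSeq V) (t : ℕ → ℝ), IsPath G p ∧ p.vert 0 = v₀ ∧ IsTimingProfile G p t ∧
    r = profileReward I p t}

/-! ### Critical times -/

open Classical in
/-- The intervals at position `i` of a path: those of the vertex `v_i`, plus the zero-length
intervals that the first and the last position additionally carry by convention (the earliest
time at which `v_0` can be left, and the latest time at which the last edge can be entered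
in its middle). -/
def pathIntervals (G : TaskGraph V) (I : IntervalMap V) (p : VSeq V) (i : ℕ) : Finset (ℝ × ℝ) :=
  I.ivl (p.vert i)
    ∪ (if i = 0 then {(lenPlus G p 0, lenPlus G p 0)} else ∅)
    ∪ (if i = p.last then {(1 - step G p p.last, 1 - step G p p.last)} else ∅)

open Classical in
/-- Vertex-pair critical times `CT(v_i, v_j)` for `i < j`: the ends of the intervals of `v_i`
(type T1), and the times at which `v_i` must be left so as to reach `v_j` at the start of an
interval of `v_j` (type T2). -/
def pairCritical (G : TaskGraph V) (I : IntervalMap V) (p : VSeq V) (i j : ℕ) : Finset ℝ :=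
  (pathIntervals G I p i).image (fun J => J.2)
    ∪ (pathIntervals G I p j).image (fun J => J.1 - (lenMinus G p j - lenPlus G p i))

open Classical in
/-- Vertex-critical times `CT_m`. A one-vertex path has no pairs; its only exit time is the end
`1` of the task (which for longer paths belongs to `CT_k` anyway). -/
def critical (G : TaskGraph V) (I : IntervalMap V) (p : VSeq V) (m : ℕ) : Finset ℝ :=
  if p.last = 0 then {1} else
    (Finset.range (p.last + 1)).biUnion fun j => (Finset.range j).biUnion fun i =>
      (pairCritical G I p i j).image (fun t => t + lenBetween G p i m)

/-- The critical times of `v_m` in the time horizon `[0, 1]`, in increasing order. -/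
def exitTimes (G : TaskGraph V) (I : IntervalMap V) (p : VSeq V) (m : ℕ) : List ℝ :=
  ((critical G I p m).filter (fun t => 0 ≤ t ∧ t ≤ 1)).sort (· ≤ ·)

/-! ### The OTP algorithm -/

/-- `compute_best_reward`: given the list `entry` of (entry time, reward) pairs, the best reward
when leaving `v` at time `tExit`, over the pairs with `t_entry + d ≤ tExit`; `none` if there is no
such pair, that is, if `v` cannot be left at time `tExit`. -/
def bestReward (I : IntervalMap V) (entry : List (ℝ × ℝ)) (v : V) (d tExit : ℝ) : Option ℝ :=
  ((entry.filter (fun q => q.1 + d ≤ tExit)).map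
    (fun q => q.2 + vertexReward I v q.1 tExit)).max?

/-- One pass of the outer loop of the OTP algorithm: run through the exit times in the given order,
keep the pairs that improve on the best reward so far, and return the list of these pairs together
with the best reward. -/
def processVertex (I : IntervalMap V) (entry : List (ℝ × ℝ)) (v : V) (d : ℝ) (times : List ℝ) :
    List (ℝ × ℝ) × ℝ :=
  times.foldl (fun s tExit =>
    match bestReward I entry v d tExit with
    | none => s
    | some r => if s.1 = [] ∨ s.2 < r then (s.1 ++ [(tExit, r)], r) else s) ([], 0)

/-- The list of (entry time, reward) pairs with which the OTP algorithm enters `v_i`, where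
`d j` is the minimal delay demanded between the exits from `v_{j-1}` and from `v_j`. -/
def entryList (G : TaskGraph V) (I : IntervalMap V) (p : VSeq V) (d : ℕ → ℝ) : ℕ → List (ℝ × ℝ)
  | 0 => [(0, 0)]
  | i + 1 => (processVertex I (entryList G I p d i) (p.vert i) (d i) (exitTimes G I p i)).1

/-- The value returned by the OTP algorithm on the path `p`. -/
def otp (G : TaskGraph V) (I : IntervalMap V) (p : VSeq V) : ℝ :=
  (processVertex I (entryList G I p (step G p) p.last) p.endpoint (step G p p.last)
    (exitTimes G I p p.last)).2

/-! ### Upper bounds -/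

/-- There is a path from `u` to `v`. -/
def Connected (G : TaskGraph V) (u v : V) : Prop :=
  ∃ p : VSeq V, IsPath G p ∧ p.vert 0 = u ∧ p.endpoint = v

/-- `δ'(u, v)`: the minimal length of a path from `u` to `v`, half of its first and half of its
last edge not counted. Only used if `Connected G u v`; an unconnected pair has `δ'(u, v) = ∞` and is never
considered. -/
def delta (G : TaskGraph V) (u v : V) : ℝ :=
  sInf {x | ∃ p : VSeq V, IsPath G p ∧ p.vert 0 = u ∧ p.endpoint = v ∧
    x = lenMinus G p p.last - lenPlus G p 0}

open Classical in
/-- All intervals of the graph, each paired with the vertex to which it belongs. -/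
def allIntervals [Fintype V] (I : IntervalMap V) : Finset (V × (ℝ × ℝ)) :=
  Finset.univ.biUnion fun v => (I.ivl v).image (fun J => (v, J))

/-- The interval `Y` can be reached from the interval `X`: leaving `X` at its start and travelling
to the vertex of `Y` one arrives no later than the end of `Y`. -/
def Reachable (G : TaskGraph V) (X Y : V × (ℝ × ℝ)) : Prop :=
  Connected G X.1 Y.1 ∧ X.2.1 + delta G X.1 Y.1 ≤ Y.2.2

open Classical in
/-- `ub_X^n`, the bound for the reward from the interval `X` and at most `n` later intervals. -/
def ubIter [Fintype V] (G : TaskGraph V) (I : IntervalMap V) : ℕ → V × (ℝ × ℝ) → ℝ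
  | 0, X => X.2.2 - X.2.1
  | n + 1, X =>
    ((allIntervals I).filter (fun Y => Reachable G X Y)).fold max (ubIter G I n X) fun Y =>
      (X.2.2 - X.2.1) + ubIter G I n Y - max 0 (X.2.2 + delta G X.1 Y.1 - Y.2.1)

/-- `ub_X`, obtained after as many iterations as the graph has intervals. -/
def ubInterval [Fintype V] (G : TaskGraph V) (I : IntervalMap V) (X : V × (ℝ × ℝ)) : ℝ :=
  ubIter G I (allIntervals I).card X

open Classical in
/-- `ub(u, t)`: the maximum of `ub_X - max {0, t + δ'(u, v) - t_s}` over the intervals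
`X = [t_s, t_e]` of vertices `v` that are connected from `u`, and of `0` (no further reward). -/
def ubVertex [Fintype V] (G : TaskGraph V) (I : IntervalMap V) (u : V) (t : ℝ) : ℝ :=
  ((allIntervals I).filter (fun X => Connected G u X.1)).fold max 0 fun X =>
    ubInterval G I X - max 0 (t + delta G u X.1 - X.2.1)

/-- `ub(π)`: the maximum over the intervals `J = [t_s, t_e]` at the positions `i` of the path of
`r + ub(v_k, t_s + ℓ⁺(v_i, v_k))`, where `r` is the best reward for leaving `v_i` at time `t_e`
in the run of the OTP algorithm on `π` with the relaxed test `t_entry ≤ t_exit` (delay `0`).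
Intervals whose end cannot be attained in that run are skipped. -/
def ubPath [Fintype V] (G : TaskGraph V) (I : IntervalMap V) (p : VSeq V) : ℝ :=
  (Finset.range (p.last + 1)).fold max 0 fun i =>
    (pathIntervals G I p i).fold max 0 fun J =>
      match bestReward I (entryList G I p (fun _ => 0) i) (p.vert i) 0 J.2 with
      | none => 0
      | some r => r + ubVertex G I p.endpoint (J.1 + lenBetween G p i p.last)

/-! ### Branch and bound -/

open Classical in
/-- The recursive branch-and-bound algorithm, called with the path `p` and the incumbent reward
`Rmax`. `nbr u` lists the out-neighbours of `u` in the order in which they are tried. The first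
argument bounds the recursion depth: the value is `none` if that depth is exceeded, and `some R`
if the recursion ends within it and the algorithm returns `R`. -/
def branchAndBound [Fintype V] (G : TaskGraph V) (I : IntervalMap V) (nbr : V → List V) :
    ℕ → VSeq V → ℝ → Option ℝ
  | 0, _, _ => none
  | n + 1, p, Rmax =>
    if 1 < lenPlus G p p.last then some 0
    else if ubPath G I p ≤ max Rmax (otp G I p) then some (max Rmax (otp G I p))
    else (nbr p.endpoint).foldlM
      (fun R w => (branchAndBound G I nbr n (p.extend w) R).map (fun R' => max R R'))
      (max Rmax (otp G I p))

/-- Every closed path with at least one edge has positive length. -/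
def PositiveCycles (G : TaskGraph V) : Prop :=
  ∀ p : VSeq V, IsPath G p → 0 < p.last → p.vert 0 = p.endpoint → 0 < lenTo G p p.last

end

end GTAP

namespace GTAP

variable {V : Type*}

/-! ### Vertex rewards -/

/-! Three facts carry the theorem: OTP is optimal on its path, `ub(π)` dominates the reward of every
extension of `π`, and long paths exceed length `1` when cycles are positive.

For OTP, pass to the shifted times `t_j - ℓ⁺(v_j)`: feasibility becomes monotonicity between `0` and
a cap. Move a block of equal shifted times together. Away from the breakpoints (interval ends on
exit, interval starts on entry) the reward is a sum of terms `max 0 (affine with integer slope)`, so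
it has an integer subgradient `m`. If `m ≤ 0`, moving the block earlier loses nothing; if `m ≥ 1`,
moving it later gains at least the delay. Repeating this makes all times critical
(`exists_rounding`), and the run of OTP dominates critical exit times (`exists_entryList`).

For `ub(π)`, cut an extension of `π` where it leaves the end of `π`. The later reward is a chain of
stays in intervals, bounded by `ub(u, t)` (`sum_length_le_ubIter`, `sum_vertexReward_le_ubVertex`).
The earlier reward is compared with the relaxed run at the last interval that pays
(`partialReward_add_ubVertex_le`). Rounding may delay exits by some `h`, but it also gains `h`,
while `ub(u, ·)` drops by at most `h` (`ubVertex_le_add`).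

Hence pruning is safe, and every returned value lies below some feasible reward and above all of
them. For termination, any `card V` consecutive edges contain a cycle, and only finitely many such
windows exist, so their lengths are bounded below by some `ε > 0`. -/

/-- The time at which `v_i` is entered, if `v_j` is left at time `t j`. -/
noncomputable def prevTime (t : ℕ → ℝ) (i : ℕ) : ℝ := if i = 0 then 0 else t (i - 1)

/-- The reward collected at the first `n` vertices. -/
noncomputable def partialReward (I : IntervalMap V) (v : ℕ → V) (t : ℕ → ℝ) (n : ℕ) : ℝ :=
  ∑ j ∈ Finset.range n, vertexReward I (v j) (prevTime t j) (t j)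

@[simp] lemma prevTime_zero (t : ℕ → ℝ) : prevTime t 0 = 0 := rfl

@[simp] lemma prevTime_succ (t : ℕ → ℝ) (i : ℕ) : prevTime t (i + 1) = t i := rfl

lemma prevTime_congr {t t' : ℕ → ℝ} {n : ℕ} (h : ∀ j < n, t j = t' j) :
    prevTime t n = prevTime t' n := by
  cases n with
  | zero => rfl
  | succ n => exact h n n.lt_succ_self

lemma partialReward_congr {I : IntervalMap V} {v v' : ℕ → V} {t t' : ℕ → ℝ} {n : ℕ}
    (hv : ∀ j < n, v j = v' j) (ht : ∀ j < n, t j = t' j) :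
    partialReward I v t n = partialReward I v' t' n := by
  refine Finset.sum_congr rfl fun j hj => ?_
  have hj := Finset.mem_range.1 hj
  rw [hv j hj, ht j hj, prevTime_congr fun i hi => ht i (hi.trans hj)]

lemma partialReward_succ (I : IntervalMap V) (v : ℕ → V) (t : ℕ → ℝ) (n : ℕ) :
    partialReward I v t (n + 1) =
      partialReward I v t n + vertexReward I (v n) (prevTime t n) (t n) :=
  Finset.sum_range_succ _ _

lemma vertexReward_nonneg (I : IntervalMap V) (u : V) (a b : ℝ) : 0 ≤ vertexReward I u a b :=
  Finset.sum_nonneg fun _ _ => le_max_left _ _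

lemma vertexReward_mono (I : IntervalMap V) (u : V) {a a' b b' : ℝ} (ha : a' ≤ a) (hb : b ≤ b') :
    vertexReward I u a b ≤ vertexReward I u a' b' := by
  refine Finset.sum_le_sum fun J _ => ?_
  gcongr

lemma vertexReward_eq_zero (I : IntervalMap V) (u : V) {a b : ℝ} (h : b ≤ a) :
    vertexReward I u a b = 0 := by
  refine Finset.sum_eq_zero fun J _ => max_eq_left ?_
  have := min_le_left b J.2
  have := le_max_left a J.1
  linarith

lemma partialReward_nonneg (I : IntervalMap V) (v : ℕ → V) (t : ℕ → ℝ) (n : ℕ) :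
    0 ≤ partialReward I v t n :=
  Finset.sum_nonneg fun _ _ => vertexReward_nonneg _ _ _ _

/-! ### Path lengths -/

section Lengths

variable {G : TaskGraph V} {p : VSeq V}

lemma isPath_single (G : TaskGraph V) (v : V) : IsPath G (VSeq.single v) :=
  fun i hi => absurd hi (by simp [VSeq.single])

lemma lenTo_succ (G : TaskGraph V) (p : VSeq V) (i : ℕ) :
    lenTo G p (i + 1) = lenTo G p i + G.len (p.vert i) (p.vert (i + 1)) :=
  Finset.sum_range_succ _ _

@[simp] lemma lenTo_zero (G : TaskGraph V) (p : VSeq V) : lenTo G p 0 = 0 := rfl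

lemma lenTo_mono (hp : IsPath G p) {i j : ℕ} (hij : i ≤ j) (hj : j ≤ p.last) :
    lenTo G p i ≤ lenTo G p j := by
  induction j, hij using Nat.le_induction with
  | base => rfl
  | succ j _ ih =>
    have := G.len_nonneg _ _ (hp j (by omega))
    rw [lenTo_succ]
    linarith [ih (by omega)]

lemma lenPlus_of_lt {i : ℕ} (hi : i < p.last) :
    lenPlus G p i = lenTo G p i + G.len (p.vert i) (p.vert (i + 1)) / 2 := by
  simp [lenPlus, hi]

@[simp] lemma lenPlus_last (G : TaskGraph V) (p : VSeq V) :
    lenPlus G p p.last = lenTo G p p.last := by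
  simp [lenPlus]

/-- Both sides measure to the middle of the same edge: leaving a vertex and entering the next are
one event. Type T2 critical times of consecutive positions simplify accordingly. -/
lemma lenMinus_succ {i : ℕ} (hi : i < p.last) : lenMinus G p (i + 1) = lenPlus G p i := by
  rw [lenPlus_of_lt hi]
  simp only [lenMinus, lenTo_succ, Nat.succ_pos, if_true, Nat.add_sub_cancel]
  ring

lemma lenPlus_le_succ (hp : IsPath G p) {i : ℕ} (hi : i < p.last) :
    lenPlus G p i ≤ lenPlus G p (i + 1) := by
  have h1 := G.len_nonneg _ _ (hp i hi)
  rw [lenPlus_of_lt hi]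
  rcases Nat.lt_or_ge (i + 1) p.last with h | h
  · have h2 := G.len_nonneg _ _ (hp (i + 1) h)
    rw [lenPlus_of_lt h, lenTo_succ]
    linarith
  · rw [lenPlus, if_neg h.not_gt, lenTo_succ]
    linarith

lemma lenPlus_mono (hp : IsPath G p) {i j : ℕ} (hij : i ≤ j) (hj : j ≤ p.last) :
    lenPlus G p i ≤ lenPlus G p j := by
  induction j, hij using Nat.le_induction with
  | base => rfl
  | succ j _ ih => exact (ih (by omega)).trans (lenPlus_le_succ hp (by omega))

lemma lenPlus_zero_nonneg (hp : IsPath G p) : 0 ≤ lenPlus G p 0 := by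
  unfold lenPlus
  split_ifs with h
  · have := G.len_nonneg _ _ (hp 0 h)
    simp only [lenTo_zero]
    linarith
  · simp

lemma lenPlus_nonneg (hp : IsPath G p) {i : ℕ} (hi : i ≤ p.last) : 0 ≤ lenPlus G p i :=
  (lenPlus_zero_nonneg hp).trans (lenPlus_mono hp i.zero_le hi)

@[simp] lemma step_zero (G : TaskGraph V) (p : VSeq V) : step G p 0 = lenPlus G p 0 := rfl

@[simp] lemma step_succ (G : TaskGraph V) (p : VSeq V) (i : ℕ) :
    step G p (i + 1) = lenPlus G p (i + 1) - lenPlus G p i := rfl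

/-- The feasibility conditions in terms of `prevTime` and `step`. -/
lemma isTimingProfile_iff {t : ℕ → ℝ} :
    IsTimingProfile G p t ↔
      (∀ j < p.last, prevTime t j + step G p j ≤ t j) ∧
        prevTime t p.last + step G p p.last ≤ 1 := by
  constructor
  · rintro ⟨h1, h2, h3⟩
    refine ⟨fun j hj => ?_, ?_⟩
    · cases j with
      | zero => simpa using h1 hj
      | succ j => simpa [lenBetween] using h2 j hj
    · rcases hk : p.last with _ | k
      · simp [lenPlus, hk]
      · have := h3 (by omega)
        simpa [hk, lenBetween] using this
  · rintro ⟨h1, h2⟩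
    refine ⟨fun h => by simpa using h1 0 h, fun i hi => by
      simpa [lenBetween] using h1 (i + 1) hi, fun h => ?_⟩
    obtain ⟨k, hk⟩ : ∃ k, p.last = k + 1 := ⟨p.last - 1, by omega⟩
    simpa [hk, lenBetween] using h2

lemma profileReward_eq (I : IntervalMap V) (p : VSeq V) (t : ℕ → ℝ) :
    profileReward I p t =
      partialReward I p.vert t p.last + vertexReward I p.endpoint (prevTime t p.last) 1 := by
  unfold profileReward partialReward
  rw [Finset.sum_range_succ]
  congr 1
  · refine Finset.sum_congr rfl fun j hj => ?_
    rw [if_neg (Finset.mem_range.1 hj).ne]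
    rfl
  · simp [prevTime, VSeq.endpoint]

/-- The delays telescope, so `t j - lenPlus G p j` is nondecreasing. These shifted times are the
coordinates used for rounding. -/
lemma le_of_steps {t : ℕ → ℝ} {n i j : ℕ} (ht : ∀ j < n, prevTime t j + step G p j ≤ t j)
    (hij : i ≤ j) (hj : j < n) : t i + (lenPlus G p j - lenPlus G p i) ≤ t j := by
  induction j, hij using Nat.le_induction with
  | base => simp
  | succ j _ ih =>
    have h1 := ht (j + 1) hj
    simp only [prevTime_succ, step_succ] at h1
    linarith [ih (by omega)]

lemma lenPlus_le_of_steps {t : ℕ → ℝ} {n j : ℕ}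
    (ht : ∀ j < n, prevTime t j + step G p j ≤ t j) (hj : j < n) : lenPlus G p j ≤ t j := by
  have h1 := le_of_steps ht j.zero_le hj
  have h2 := ht 0 (by omega)
  simp only [prevTime_zero, step_zero] at h2
  linarith

end Lengths

/-! ### Extensions of a path -/

/-- `q` starts with `p`. -/
def Extends (p q : VSeq V) : Prop := p.last ≤ q.last ∧ ∀ i ≤ p.last, q.vert i = p.vert i

section Extends

variable {G : TaskGraph V} {p q : VSeq V}

lemma Extends.lenTo_eq (h : Extends p q) {i : ℕ} (hi : i ≤ p.last) :
    lenTo G q i = lenTo G p i := by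
  refine Finset.sum_congr rfl fun j hj => ?_
  have := Finset.mem_range.1 hj
  rw [h.2 j (by omega), h.2 (j + 1) (by omega)]

lemma Extends.lenPlus_eq (h : Extends p q) {i : ℕ} (hi : i < p.last) :
    lenPlus G q i = lenPlus G p i := by
  rw [lenPlus_of_lt hi, lenPlus_of_lt (hi.trans_le h.1), h.lenTo_eq hi.le, h.2 i hi.le,
    h.2 (i + 1) hi]

lemma Extends.lenPlus_last_le (hq : IsPath G q) (h : Extends p q) :
    lenPlus G p p.last ≤ lenPlus G q p.last := by
  rw [lenPlus_last, ← h.lenTo_eq le_rfl]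
  unfold lenPlus
  split_ifs with h'
  · have := G.len_nonneg _ _ (hq _ h')
    linarith
  · simp

lemma Extends.isPath (hq : IsPath G q) (h : Extends p q) : IsPath G p := fun i hi => by
  rw [← h.2 i hi.le, ← h.2 (i + 1) hi]
  exact hq i (hi.trans_le h.1)

/-- Only the last position of `p` can differ: its outgoing half edge counts in `q` but not in `p`.
Exit times that are feasible along `q` therefore remain feasible along `p`. -/
lemma Extends.step_le (hq : IsPath G q) (h : Extends p q) {i : ℕ} (hi : i ≤ p.last) :
    step G p i ≤ step G q i := by
  have key : lenPlus G p i ≤ lenPlus G q i := by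
    rcases hi.lt_or_eq with h' | rfl
    · rw [h.lenPlus_eq h']
    · exact h.lenPlus_last_le hq
  cases i with
  | zero => simpa using key
  | succ i =>
    rw [step_succ, step_succ, h.lenPlus_eq (by omega : i < p.last)]
    linarith

lemma Extends.single_or_extend (hq : IsPath G q) (h : Extends p q) :
    q.last = p.last ∨ ∃ w, G.Adj p.endpoint w ∧ Extends (p.extend w) q := by
  rcases h.1.eq_or_lt with h' | h'
  · exact Or.inl h'.symm
  · refine Or.inr ⟨q.vert (p.last + 1), ?_, h', fun i hi => ?_⟩
    · rw [VSeq.endpoint, ← h.2 _ le_rfl]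
      exact hq _ h'
    · simp only [VSeq.extend] at hi ⊢
      split_ifs with h''
      · exact h.2 i h''
      · congr 1
        omega

lemma isPath_extend (hp : IsPath G p) {w : V} (hw : G.Adj p.endpoint w) :
    IsPath G (p.extend w) := by
  intro i hi
  simp only [VSeq.extend] at hi ⊢
  rcases Nat.lt_succ_iff_lt_or_eq.1 hi with h | rfl
  · rw [if_pos h.le, if_pos (by omega)]
    exact hp i h
  · simpa [VSeq.endpoint] using hw

lemma extend_vert_zero (p : VSeq V) (w : V) : (p.extend w).vert 0 = p.vert 0 := by
  simp [VSeq.extend]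

end Extends

/-! ### Runs of the OTP algorithm -/

section Run

variable {I : IntervalMap V} {entry : List (ℝ × ℝ)} {v : V} {d t r : ℝ}

lemma bestReward_eq_some_iff :
    bestReward I entry v d t = some r ↔
      (∃ q ∈ entry, q.1 + d ≤ t ∧ q.2 + vertexReward I v q.1 t = r) ∧
        ∀ q ∈ entry, q.1 + d ≤ t → q.2 + vertexReward I v q.1 t ≤ r := by
  unfold bestReward
  rw [List.max?_eq_some_iff]
  simp only [List.mem_map, List.mem_filter, decide_eq_true_eq, forall_exists_index, and_imp]
  constructor
  · rintro ⟨⟨q, ⟨h1, h2⟩, h3⟩, h4⟩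
    exact ⟨⟨q, h1, h2, h3⟩, fun q' h5 h6 => h4 _ q' h5 h6 rfl⟩
  · rintro ⟨⟨q, h1, h2, h3⟩, h4⟩
    refine ⟨⟨q, ⟨h1, h2⟩, h3⟩, ?_⟩
    rintro _ q' h5 h6 rfl
    exact h4 q' h5 h6

lemma exists_bestReward {q : ℝ × ℝ} (hq : q ∈ entry) (hqt : q.1 + d ≤ t) :
    ∃ r, bestReward I entry v d t = some r ∧ q.2 + vertexReward I v q.1 t ≤ r := by
  rcases h : bestReward I entry v d t with _ | r
  · unfold bestReward at h
    rw [List.max?_eq_none_iff, List.map_eq_nil_iff, List.filter_eq_nil_iff] at h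
    exact absurd (by simpa using hqt) (h q hq)
  · exact ⟨r, rfl, (bestReward_eq_some_iff.1 h).2 q hq hqt⟩

lemma processVertex_append (I : IntervalMap V) (entry : List (ℝ × ℝ)) (v : V) (d t : ℝ)
    (times : List ℝ) :
    processVertex I entry v d (times ++ [t]) =
      match bestReward I entry v d t with
      | none => processVertex I entry v d times
      | some r =>
        if (processVertex I entry v d times).1 = [] ∨ (processVertex I entry v d times).2 < r then
          ((processVertex I entry v d times).1 ++ [(t, r)], r)
        else processVertex I entry v d times := by
  simp only [processVertex, List.foldl_append, List.foldl_cons, List.foldl_nil]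
  rcases bestReward I entry v d t with _ | r <;> rfl

/-- The exit list only holds pairs of an exit time and the best reward for it. -/
lemma mem_processVertex {times : List ℝ} {q : ℝ × ℝ}
    (hq : q ∈ (processVertex I entry v d times).1) :
    q.1 ∈ times ∧ bestReward I entry v d q.1 = some q.2 := by
  induction times using List.reverseRecOn with
  | nil => simp [processVertex] at hq
  | append_singleton times t ih =>
    rw [processVertex_append] at hq
    rcases hb : bestReward I entry v d t with _ | r
    · simp only [hb] at hq
      exact ⟨List.mem_append_left _ (ih hq).1, (ih hq).2⟩
    · simp only [hb] at hq
      split_ifs at hq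
      · rcases List.mem_append.1 hq with h | h
        · exact ⟨List.mem_append_left _ (ih h).1, (ih h).2⟩
        · obtain rfl := List.mem_singleton.1 h
          exact ⟨by simp, hb⟩
      · exact ⟨List.mem_append_left _ (ih hq).1, (ih hq).2⟩

lemma processVertex_snd (I : IntervalMap V) (entry : List (ℝ × ℝ)) (v : V) (d : ℝ)
    (times : List ℝ) :
    (processVertex I entry v d times).2 = 0 ∨
      ∃ q ∈ (processVertex I entry v d times).1, q.2 = (processVertex I entry v d times).2 := by
  induction times using List.reverseRecOn with
  | nil => exact Or.inl rfl
  | append_singleton times t ih =>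
    rw [processVertex_append]
    rcases bestReward I entry v d t with _ | r
    · exact ih
    · dsimp only
      split_ifs
      · exact Or.inr ⟨(t, r), by simp, rfl⟩
      · exact ih

/-- Every feasible exit time is dominated by an element of the exit list. -/
lemma exists_mem_processVertex {times : List ℝ} (hs : times.Pairwise (· ≤ ·)) (ht : t ∈ times)
    (hr : bestReward I entry v d t = some r) :
    (∃ q ∈ (processVertex I entry v d times).1, q.1 ≤ t ∧ r ≤ q.2) ∧
      r ≤ (processVertex I entry v d times).2 := by
  -- The middle clause serves the induction: an exit time that is dropped for lack of improvement is
  -- dominated by the pair attaining the current maximum, which is earlier because the times are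
  -- sorted.
  suffices H : (∀ q ∈ (processVertex I entry v d times).1,
        q.2 ≤ (processVertex I entry v d times).2) ∧
      ((processVertex I entry v d times).1 ≠ [] →
        ∃ q ∈ (processVertex I entry v d times).1, q.2 = (processVertex I entry v d times).2) ∧
      ∀ t ∈ times, ∀ r, bestReward I entry v d t = some r →
        ∃ q ∈ (processVertex I entry v d times).1, q.1 ≤ t ∧ r ≤ q.2 by
    obtain ⟨q, h1, h2, h3⟩ := H.2.2 t ht r hr
    exact ⟨⟨q, h1, h2, h3⟩, h3.trans (H.1 q h1)⟩
  clear ht hr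
  induction times using List.reverseRecOn with
  | nil => simp [processVertex]
  | append_singleton times t ih =>
    rw [List.pairwise_append] at hs
    obtain ⟨ih1, ih2, ih3⟩ := ih hs.1
    have hlast : ∀ q ∈ (processVertex I entry v d times).1, q.1 ≤ t := fun q hq =>
      hs.2.2 _ (mem_processVertex hq).1 _ (by simp)
    rw [processVertex_append]
    rcases hb : bestReward I entry v d t with _ | r
    · refine ⟨ih1, ih2, fun t' ht' r' hr' => ?_⟩
      rcases List.mem_append.1 ht' with h | h
      · exact ih3 t' h r' hr'
      · rw [List.mem_singleton.1 h, hb] at hr'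
        cases hr'
    · dsimp only
      split_ifs with hc
      · refine ⟨fun q hq => ?_, fun _ => ⟨(t, r), by simp, rfl⟩, fun t' ht' r' hr' => ?_⟩
        · rcases List.mem_append.1 hq with h | h
          · rcases hc with hc | hc
            · simp [hc] at h
            · exact (ih1 q h).trans hc.le
          · rw [List.mem_singleton.1 h]
        · rcases List.mem_append.1 ht' with h | h
          · obtain ⟨q, h1, h2⟩ := ih3 t' h r' hr'
            exact ⟨q, List.mem_append_left _ h1, h2⟩
          · rw [List.mem_singleton.1 h, hb] at hr'
            cases hr'
            exact ⟨(t, r), by simp, (List.mem_singleton.1 h).ge, le_rfl⟩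
      · refine ⟨ih1, ih2, fun t' ht' r' hr' => ?_⟩
        rcases List.mem_append.1 ht' with h | h
        · exact ih3 t' h r' hr'
        · rw [List.mem_singleton.1 h, hb] at hr'
          cases hr'
          rw [not_or, not_lt] at hc
          obtain ⟨q, h1, h2⟩ := ih2 hc.1
          exact ⟨q, h1, (hlast q h1).trans (List.mem_singleton.1 h).ge, hc.2.trans h2.ge⟩

end Run

section Runs

variable {G : TaskGraph V} {I : IntervalMap V} {p : VSeq V} {d : ℕ → ℝ}

lemma mem_exitTimes {m : ℕ} {t : ℝ} :
    t ∈ exitTimes G I p m ↔ t ∈ critical G I p m ∧ 0 ≤ t ∧ t ≤ 1 := by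
  simp [exitTimes]

lemma pairwise_exitTimes (m : ℕ) : (exitTimes G I p m).Pairwise (· ≤ ·) :=
  Finset.pairwise_sort _ _

/-- Leaving the vertices at exit times of the algorithm that respect the delays is dominated by
the run of the algorithm. -/
lemma exists_entryList {t : ℕ → ℝ} {n : ℕ} (h : ∀ j < n, t j ∈ exitTimes G I p j)
    (hd : ∀ j < n, prevTime t j + d j ≤ t j) :
    ∃ q ∈ entryList G I p d n, q.1 ≤ prevTime t n ∧ partialReward I p.vert t n ≤ q.2 := by
  induction n with
  | zero => exact ⟨(0, 0), by simp [entryList], le_rfl, le_rfl⟩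
  | succ n ih =>
    obtain ⟨q, h1, h2, h3⟩ := ih (fun j hj => h j (by omega)) fun j hj => hd j (by omega)
    obtain ⟨r, hr, hqr⟩ := exists_bestReward (I := I) (v := p.vert n) (d := d n) (t := t n) h1
      (by linarith [hd n n.lt_succ_self])
    obtain ⟨⟨q', h4, h5, h6⟩, -⟩ :=
      exists_mem_processVertex (pairwise_exitTimes n) (h n n.lt_succ_self) hr
    refine ⟨q', h4, h5, ?_⟩
    rw [partialReward_succ]
    have := vertexReward_mono I (p.vert n) h2 (le_refl (t n))
    linarith

lemma exists_bestReward_of_exitTimes {t : ℕ → ℝ} {n : ℕ} {s : ℝ}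
    (h : ∀ j < n, t j ∈ exitTimes G I p j) (hd : ∀ j < n, prevTime t j + d j ≤ t j)
    (hs : prevTime t n + d n ≤ s) :
    ∃ r, bestReward I (entryList G I p d n) (p.vert n) (d n) s = some r ∧
      partialReward I p.vert t n + vertexReward I (p.vert n) (prevTime t n) s ≤ r := by
  obtain ⟨q, h1, h2, h3⟩ := exists_entryList h hd
  obtain ⟨r, hr, hqr⟩ := exists_bestReward (I := I) (v := p.vert n) (d := d n) (t := s) h1
    (by linarith)
  have := vertexReward_mono I (p.vert n) h2 (le_refl s)
  exact ⟨r, hr, by linarith⟩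

/-- The entries of a run come from exit times that respect the delays. -/
lemma exists_of_mem_entryList {n : ℕ} {q : ℝ × ℝ} (hq : q ∈ entryList G I p d n) :
    ∃ t : ℕ → ℝ, (∀ j < n, prevTime t j + d j ≤ t j) ∧ prevTime t n = q.1 ∧
      partialReward I p.vert t n = q.2 := by
  induction n generalizing q with
  | zero =>
    simp only [entryList, List.mem_singleton] at hq
    subst hq
    exact ⟨fun _ => 0, by simp, rfl, rfl⟩
  | succ n ih =>
    obtain ⟨⟨q', h1, h2, h3⟩, -⟩ := bestReward_eq_some_iff.1 (mem_processVertex hq).2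
    obtain ⟨t, h4, h5, h6⟩ := ih h1
    have hc : ∀ j < n, Function.update t n q.1 j = t j := fun j hj =>
      Function.update_of_ne hj.ne _ _
    refine ⟨Function.update t n q.1, fun j hj => ?_, by simp, ?_⟩
    · rw [prevTime_congr fun i hi => hc i (by omega)]
      rcases Nat.lt_succ_iff_lt_or_eq.1 hj with h | rfl
      · rw [hc j h]
        exact h4 j h
      · rwa [Function.update_self, h5]
    · rw [partialReward_succ, partialReward_congr (fun _ _ => rfl) hc, prevTime_congr hc,
        Function.update_self, h5, h6, h3]

lemma optpRewards_nonneg {v₀ : V} {r : ℝ} (hr : r ∈ optpRewards G I v₀) : 0 ≤ r := by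
  obtain ⟨p, t, -, -, -, rfl⟩ := hr
  rw [profileReward_eq]
  exact add_nonneg (partialReward_nonneg _ _ _ _) (vertexReward_nonneg _ _ _ _)

lemma optpRewards_nonempty (G : TaskGraph V) (I : IntervalMap V) (v₀ : V) :
    (optpRewards G I v₀).Nonempty :=
  ⟨_, VSeq.single v₀, fun _ => 0, isPath_single G v₀, rfl,
    ⟨fun h => absurd h (by simp [VSeq.single]), fun i hi => absurd hi (by simp [VSeq.single]),
      fun h => absurd h (by simp [VSeq.single])⟩, rfl⟩

/-- The OTP algorithm does not exceed the rewards of the feasible solutions. -/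
lemma otp_le (hp : IsPath G p) : ∃ r ∈ optpRewards G I (p.vert 0), otp G I p ≤ r := by
  unfold otp
  rcases processVertex_snd I (entryList G I p (step G p) p.last) p.endpoint (step G p p.last)
    (exitTimes G I p p.last) with h | ⟨q, hq, h⟩
  · obtain ⟨r, hr⟩ := optpRewards_nonempty G I (p.vert 0)
    exact ⟨r, hr, h.trans_le (optpRewards_nonneg hr)⟩
  · obtain ⟨h1, h2⟩ := mem_processVertex hq
    obtain ⟨⟨q', h3, h4, h5⟩, -⟩ := bestReward_eq_some_iff.1 h2
    obtain ⟨t, h6, h7, h8⟩ := exists_of_mem_entryList h3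
    have hq1 := (mem_exitTimes.1 h1).2.2
    refine ⟨profileReward I p t, ⟨p, t, hp, rfl, isTimingProfile_iff.2 ⟨h6, ?_⟩, rfl⟩, ?_⟩
    · rw [h7]
      exact h4.trans hq1
    · rw [← h, profileReward_eq, h7, h8, ← h5]
      -- The last exit may happen before time `1`; staying until `1` loses nothing.
      have := vertexReward_mono I p.endpoint (le_refl q'.1) hq1
      linarith

end Runs

/-! ### Rounding of exit times to critical times -/

/-- `φ` is affine with an integer slope between `lo` and `hi`, seen from `x`. -/
def IntAffine (lo hi x : ℝ) (φ : ℝ → ℝ) : Prop :=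
  ∃ m : ℤ, ∀ y, lo ≤ y → y ≤ hi → φ y = φ x + m * (y - x)

/-- Between `lo` and `hi`, `φ` has an integer subgradient at `x`. -/
def IntSubgradient (lo hi x : ℝ) (φ : ℝ → ℝ) : Prop :=
  ∃ m : ℤ, ∀ y, lo ≤ y → y ≤ hi → φ x + m * (y - x) ≤ φ y

section IntSubgradient

variable {lo hi x : ℝ} {φ ψ : ℝ → ℝ}

lemma IntAffine.const (lo hi x c : ℝ) : IntAffine lo hi x fun _ => c :=
  ⟨0, fun _ _ _ => by simp⟩

lemma IntAffine.add_const (lo hi x c : ℝ) : IntAffine lo hi x fun y => y + c :=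
  ⟨1, fun _ _ _ => by push_cast; ring⟩

lemma IntAffine.sub (hφ : IntAffine lo hi x φ) (hψ : IntAffine lo hi x ψ) :
    IntAffine lo hi x fun y => φ y - ψ y := by
  obtain ⟨m, hm⟩ := hφ
  obtain ⟨n, hn⟩ := hψ
  refine ⟨m - n, fun y h1 h2 => ?_⟩
  simp only [hm y h1 h2, hn y h1 h2]
  push_cast
  ring

lemma IntAffine.congr (hx : lo ≤ x) (hx' : x ≤ hi) (hφ : IntAffine lo hi x φ)
    (h : ∀ y, lo ≤ y → y ≤ hi → ψ y = φ y) : IntAffine lo hi x ψ := by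
  obtain ⟨m, hm⟩ := hφ
  exact ⟨m, fun y h1 h2 => by rw [h y h1 h2, h x hx hx', hm y h1 h2]⟩

/-- Truncation at `0` is convex, so a kink between `lo` and `hi` does no harm. -/
lemma IntAffine.max_zero (hφ : IntAffine lo hi x φ) :
    IntSubgradient lo hi x fun y => max 0 (φ y) := by
  obtain ⟨m, hm⟩ := hφ
  rcases le_total 0 (φ x) with h | h
  · exact ⟨m, fun y h1 h2 => by
      simp only [max_eq_right h, ← hm y h1 h2]
      exact le_max_right _ _⟩
  · exact ⟨0, fun y _ _ => by simp [h]⟩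

lemma IntSubgradient.add (hφ : IntSubgradient lo hi x φ) (hψ : IntSubgradient lo hi x ψ) :
    IntSubgradient lo hi x fun y => φ y + ψ y := by
  obtain ⟨m, hm⟩ := hφ
  obtain ⟨n, hn⟩ := hψ
  refine ⟨m + n, fun y h1 h2 => ?_⟩
  have := hm y h1 h2
  have := hn y h1 h2
  push_cast
  linarith

lemma IntSubgradient.sum {ι : Type*} {s : Finset ι} {f : ι → ℝ → ℝ}
    (h : ∀ i ∈ s, IntSubgradient lo hi x (f i)) :
    IntSubgradient lo hi x fun y => ∑ i ∈ s, f i y := by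
  classical
  induction s using Finset.induction_on with
  | empty => exact ⟨0, fun y _ _ => by simp⟩
  | insert a s ha ih =>
    simp only [Finset.sum_insert ha]
    exact (h a (by simp)).add (ih fun i hi => h i (by simp [hi]))

/-- A function that is constant or a translation. -/
def IsShift (φ : ℝ → ℝ) (L : ℝ) : Prop := (∃ c, φ = fun _ => c) ∨ φ = fun y => y + L

lemma IsShift.min_const (hx : lo ≤ x) (hx' : x ≤ hi) {L e : ℝ} (h : IsShift φ L)
    (he : e - L ≤ lo ∨ hi ≤ e - L) : IntAffine lo hi x fun y => min (φ y) e := by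
  rcases h with ⟨c, rfl⟩ | rfl
  · exact .const _ _ _ _
  rcases he with he | he
  · exact (IntAffine.const lo hi x e).congr hx hx' fun y h1 _ => min_eq_right (by linarith)
  · exact (IntAffine.add_const lo hi x L).congr hx hx' fun y _ h2 => min_eq_left (by linarith)

lemma IsShift.max_const (hx : lo ≤ x) (hx' : x ≤ hi) {L e : ℝ} (h : IsShift φ L)
    (he : e - L ≤ lo ∨ hi ≤ e - L) : IntAffine lo hi x fun y => max (φ y) e := by
  rcases h with ⟨c, rfl⟩ | rfl
  · exact .const _ _ _ _
  rcases he with he | he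
  · exact (IntAffine.add_const lo hi x L).congr hx hx' fun y h1 _ => max_eq_left (by linarith)
  · exact (IntAffine.const lo hi x e).congr hx hx' fun y _ h2 => max_eq_right (by linarith)

/-- Only the concave kinks must be excluded: entry at the start of an interval and exit at its end.
The opposite kinks, where an overlap begins or vanishes, come from the outer `max 0` and are convex.
This is why the critical times pair ends with exits and starts with entries only. -/
lemma IsShift.vertexReward (hx : lo ≤ x) (hx' : x ≤ hi) {I : IntervalMap V} {u : V} {a b : ℝ}
    (hφ : IsShift φ a) (hψ : IsShift ψ b)
    (hs : (∃ c, φ = fun _ => c) ∨ ∀ J ∈ I.ivl u, J.1 - a ≤ lo ∨ hi ≤ J.1 - a)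
    (he : (∃ c, ψ = fun _ => c) ∨ ∀ J ∈ I.ivl u, J.2 - b ≤ lo ∨ hi ≤ J.2 - b) :
    IntSubgradient lo hi x fun y => vertexReward I u (φ y) (ψ y) := by
  refine IntSubgradient.sum fun J hJ => IntAffine.max_zero (IntAffine.sub ?_ ?_)
  · rcases he with ⟨c, rfl⟩ | he
    · exact .const _ _ _ _
    · exact hψ.min_const hx hx' (he J hJ)
  · rcases hs with ⟨c, rfl⟩ | hs
    · exact .const _ _ _ _
    · exact hφ.max_const hx hx' (hs J hJ)

end IntSubgradient

/-- Reward at the first `n + 1` vertices when the task ends at time `H` and vertex `j < n` is left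
at time `τ j + L j`. -/
noncomputable def shiftReward (I : IntervalMap V) (v : ℕ → V) (L : ℕ → ℝ) (H : ℝ) (n : ℕ)
    (τ : ℕ → ℝ) : ℝ :=
  partialReward I v (fun j => τ j + L j) n +
    vertexReward I (v n) (prevTime (fun j => τ j + L j) n) H

lemma shiftReward_intSubgradient {I : IntervalMap V} {v : ℕ → V} {L τ : ℕ → ℝ} {H lo hi x : ℝ}
    {n : ℕ} (hx : lo ≤ x) (hx' : x ≤ hi)
    (he : ∀ j < n, ∀ J ∈ I.ivl (v j), J.2 - L j ≤ lo ∨ hi ≤ J.2 - L j)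
    (hs : ∀ j < n, ∀ J ∈ I.ivl (v (j + 1)), J.1 - L j ≤ lo ∨ hi ≤ J.1 - L j) :
    IntSubgradient lo hi x fun y =>
      shiftReward I v L H n fun j => if τ j = x then y else τ j := by
  have hshift : ∀ j, IsShift (fun y => (if τ j = x then y else τ j) + L j) (L j) := by
    intro j
    by_cases h : τ j = x
    · exact Or.inr (by simp [h])
    · exact Or.inl ⟨τ j + L j, by simp [h]⟩
  refine IntSubgradient.add (IntSubgradient.sum fun j hj => ?_) ?_
  · have hj := Finset.mem_range.1 hj
    cases j with
    | zero =>
      exact IsShift.vertexReward (a := 0) hx hx' (Or.inl ⟨0, rfl⟩) (hshift 0) (Or.inl ⟨0, rfl⟩)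
        (Or.inr (he 0 hj))
    | succ j =>
      exact IsShift.vertexReward hx hx' (hshift j) (hshift (j + 1)) (Or.inr (hs j (by omega)))
        (Or.inr (he _ hj))
  · cases n with
    | zero =>
      exact ⟨0, fun _ _ _ => by simp⟩
    | succ j =>
      exact IsShift.vertexReward (b := 0) hx hx' (hshift j) (Or.inl ⟨H, rfl⟩)
        (Or.inr (hs j (by omega))) (Or.inl ⟨H, rfl⟩)

/-- Shifted exit times can be rounded to values at which the reward has breakpoints, so that the
reward increases at least by as much as exit times are delayed. -/
lemma exists_rounding {I : IntervalMap V} {v : ℕ → V} {L : ℕ → ℝ} {H : ℝ} {n : ℕ} (D : Finset ℝ)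
    {cap : ℝ} (h0 : 0 ∈ D) (hcap : cap ∈ D)
    (he : ∀ j < n, ∀ J ∈ I.ivl (v j), J.2 - L j ∈ D)
    (hs : ∀ j < n, ∀ J ∈ I.ivl (v (j + 1)), J.1 - L j ∈ D)
    (τ : ℕ → ℝ) (hmono : ∀ i j, i ≤ j → j < n → τ i ≤ τ j)
    (hτ : ∀ j < n, 0 ≤ τ j ∧ τ j ≤ cap) :
    ∃ (σ : ℕ → ℝ) (h : ℝ), 0 ≤ h ∧ (∀ i j, i ≤ j → j < n → σ i ≤ σ j) ∧
      (∀ j < n, 0 ≤ σ j ∧ σ j ≤ cap ∧ σ j ∈ D ∧ σ j ≤ τ j + h) ∧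
      shiftReward I v L H n τ + h ≤ shiftReward I v L H n σ := by
  classical
  -- The induction is on the number of distinct values outside `D`. Each move makes one of them
  -- disappear and creates none.
  induction hN : (((Finset.range n).image τ) \ D).card using Nat.strong_induction_on
    generalizing τ with
  | _ N ih =>
  by_cases hall : ∀ j < n, τ j ∈ D
  · exact ⟨τ, 0, le_rfl, hmono, fun j hj => ⟨(hτ j hj).1, (hτ j hj).2, hall j hj, by simp⟩,
      by simp⟩
  push Not at hall
  obtain ⟨k, hk, hkD⟩ := hall
  obtain ⟨x, hx⟩ : ∃ x, x = τ k := ⟨_, rfl⟩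
  rw [← hx] at hkD
  have hx0 : 0 < x := lt_of_le_of_ne (hx ▸ (hτ k hk).1) fun h => hkD (h ▸ h0)
  have hxc : x < cap := lt_of_le_of_ne (hx ▸ (hτ k hk).2) fun h => hkD (h ▸ hcap)
  -- The values of `τ` are included so that a moving block stops when it meets another block; this
  -- preserves monotonicity.
  set P := D ∪ (Finset.range n).image τ with hP
  obtain ⟨lo, hlo, hlomax⟩ := (P.filter (· < x)).exists_max_image id
    ⟨0, by simp [hP, h0, hx0]⟩
  obtain ⟨hi, hhi, hhimin⟩ := (P.filter (x < ·)).exists_min_image id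
    ⟨cap, by simp [hP, hcap, hxc]⟩
  simp only [Finset.mem_filter, id] at hlo hhi hlomax hhimin
  have hsep : ∀ y ∈ P, y ≠ x → y ≤ lo ∨ hi ≤ y := fun y hy hyx => by
    rcases lt_or_gt_of_ne hyx with h | h
    · exact Or.inl (hlomax y ⟨hy, h⟩)
    · exact Or.inr (hhimin y ⟨hy, h⟩)
  have hDP : ∀ y ∈ D, y ≤ lo ∨ hi ≤ y := fun y hy =>
    hsep y (Finset.mem_union_left _ hy) fun h => hkD (h ▸ hy)
  have hτP : ∀ j < n, τ j ∈ P := fun j hj =>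
    Finset.mem_union_right _ (Finset.mem_image_of_mem _ (Finset.mem_range.2 hj))
  have hlo0 : 0 ≤ lo := hlomax 0 ⟨Finset.mem_union_left _ h0, hx0⟩
  have hhic : hi ≤ cap := hhimin cap ⟨Finset.mem_union_left _ hcap, hxc⟩
  obtain ⟨m, hm⟩ := shiftReward_intSubgradient (I := I) (v := v) (L := L) (τ := τ) (H := H)
    (n := n) hlo.2.le hhi.2.le (fun j hj J hJ => hDP _ (he j hj J hJ))
    (fun j hj J hJ => hDP _ (hs j hj J hJ))
  have hτx : (fun j => if τ j = x then x else τ j) = τ := by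
    funext j
    split_ifs with h
    · exact h.symm
    · rfl
  dsimp only at hm
  rw [hτx] at hm
  have hmove : ∀ y ∈ P, lo ≤ y → y ≤ hi → y ≠ x →
      ∃ (σ : ℕ → ℝ) (h : ℝ), 0 ≤ h ∧ (∀ i j, i ≤ j → j < n → σ i ≤ σ j) ∧
      (∀ j < n, 0 ≤ σ j ∧ σ j ≤ cap ∧ σ j ∈ D ∧
        σ j ≤ (if τ j = x then y else τ j) + h) ∧
      shiftReward I v L H n (fun j => if τ j = x then y else τ j) + h ≤
        shiftReward I v L H n σ := by
    intro y hy hly hyh hyx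
    refine ih _ ?_ (fun j => if τ j = x then y else τ j) ?_ ?_ rfl
    · rw [← hN]
      refine Finset.card_lt_card ⟨fun z hz => ?_, fun hsub => ?_⟩
      · simp only [Finset.mem_sdiff, Finset.mem_image, Finset.mem_range] at hz ⊢
        obtain ⟨⟨j, hj, rfl⟩, hzD⟩ := hz
        refine ⟨?_, hzD⟩
        split_ifs at hzD ⊢ with h
        · simp only [hP, Finset.mem_union, Finset.mem_image, Finset.mem_range] at hy
          exact hy.resolve_left hzD
        · exact ⟨j, hj, rfl⟩
      · have hxm : x ∈ (Finset.range n).image τ \ D := by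
          simp only [Finset.mem_sdiff, Finset.mem_image, Finset.mem_range]
          exact ⟨⟨k, hk, hx.symm⟩, hkD⟩
        have := hsub hxm
        simp only [Finset.mem_sdiff, Finset.mem_image, Finset.mem_range] at this
        obtain ⟨⟨j, -, hj⟩, -⟩ := this
        split_ifs at hj with h
        · exact hyx hj
        · exact h hj
    · intro i j hij hj
      have h1 := hmono i j hij hj
      split_ifs with h2 h3 h3
      · exact le_rfl
      · rcases hsep _ (hτP j hj) h3 with h | h <;> linarith [hlo.2]
      · rcases hsep _ (hτP i (by omega)) h2 with h | h <;> linarith [hhi.2]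
      · exact h1
    · intro j hj
      split_ifs
      · exact ⟨hlo0.trans hly, hyh.trans hhic⟩
      · exact hτ j hj
  -- Integrality matters here: a positive slope is at least `1`, so a move to `hi` gains at least
  -- the delay `hi - x`.
  rcases le_or_gt m 0 with hm0 | hm0
  · obtain ⟨σ, h, h1, h2, h3, h4⟩ :=
      hmove lo hlo.1 le_rfl (hlo.2.trans hhi.2).le hlo.2.ne
    have h5 := hm lo le_rfl (hlo.2.trans hhi.2).le
    have h6 : (0 : ℝ) ≤ m * (lo - x) :=
      mul_nonneg_of_nonpos_of_nonpos (by exact_mod_cast hm0) (by linarith [hlo.2])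
    refine ⟨σ, h, h1, h2, fun j hj => ?_, by linarith⟩
    obtain ⟨a, b, c, e⟩ := h3 j hj
    refine ⟨a, b, c, e.trans ?_⟩
    split_ifs with hjx
    · linarith [hlo.2]
    · rfl
  · obtain ⟨σ, h, h1, h2, h3, h4⟩ :=
      hmove hi hhi.1 (hlo.2.trans hhi.2).le le_rfl hhi.2.ne'
    have h5 := hm hi (hlo.2.trans hhi.2).le le_rfl
    have h6 : (1 : ℝ) * (hi - x) ≤ m * (hi - x) :=
      mul_le_mul_of_nonneg_right (by exact_mod_cast hm0) (by linarith [hhi.2])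
    refine ⟨σ, h + (hi - x), by linarith [hhi.2], h2, fun j hj => ?_, by linarith⟩
    obtain ⟨a, b, c, e⟩ := h3 j hj
    refine ⟨a, b, c, e.trans ?_⟩
    split_ifs with hjx
    · linarith
    · linarith [hhi.2]

/-! ### Critical times up to the shift by the path length -/

open Classical in
/-- Critical times, shifted so that they do not depend on the vertex. -/
noncomputable def shiftedCritical (G : TaskGraph V) (I : IntervalMap V) (p : VSeq V) : Finset ℝ :=
  {0, 1 - lenPlus G p p.last} ∪
    ((Finset.range p.last).biUnion fun j =>
      (I.ivl (p.vert j)).image (fun J => J.2 - lenPlus G p j) ∪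
        (I.ivl (p.vert (j + 1))).image (fun J => J.1 - lenPlus G p j))

section Critical

variable {G : TaskGraph V} {I : IntervalMap V} {p : VSeq V}

lemma mem_critical {i j m : ℕ} (hij : i < j) (hj : j ≤ p.last) {t : ℝ}
    (ht : t ∈ pairCritical G I p i j) : t + lenBetween G p i m ∈ critical G I p m := by
  rw [critical, if_neg (by omega)]
  simp only [Finset.mem_biUnion, Finset.mem_range, Finset.mem_image]
  exact ⟨j, by omega, i, hij, t, ht, rfl⟩

lemma end_mem_critical {j m : ℕ} (hj : j < p.last) {J : ℝ × ℝ}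
    (hJ : J ∈ pathIntervals G I p j) : J.2 - lenPlus G p j + lenPlus G p m ∈ critical G I p m := by
  have h : J.2 ∈ pairCritical G I p j (j + 1) :=
    Finset.mem_union_left _ (Finset.mem_image_of_mem _ hJ)
  convert mem_critical (Nat.lt_succ_self j) hj h using 1
  unfold lenBetween
  ring

lemma start_mem_critical {j m : ℕ} (hj : j < p.last) {J : ℝ × ℝ}
    (hJ : J ∈ pathIntervals G I p (j + 1)) :
    J.1 - lenPlus G p j + lenPlus G p m ∈ critical G I p m := by
  have h : J.1 - (lenMinus G p (j + 1) - lenPlus G p j) ∈ pairCritical G I p j (j + 1) :=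
    Finset.mem_union_right _ (Finset.mem_image_of_mem
      (fun J : ℝ × ℝ => J.1 - (lenMinus G p (j + 1) - lenPlus G p j)) hJ)
  convert mem_critical (Nat.lt_succ_self j) hj h using 1
  rw [lenMinus_succ hj]
  unfold lenBetween
  ring

lemma ivl_subset_pathIntervals {i : ℕ} {J : ℝ × ℝ} (hJ : J ∈ I.ivl (p.vert i)) :
    J ∈ pathIntervals G I p i := by
  simp [pathIntervals, hJ]

lemma first_mem_pathIntervals (G : TaskGraph V) (I : IntervalMap V) (p : VSeq V) :
    (lenPlus G p 0, lenPlus G p 0) ∈ pathIntervals G I p 0 := by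
  simp [pathIntervals]

lemma last_mem_pathIntervals (G : TaskGraph V) (I : IntervalMap V) (p : VSeq V) :
    (1 - step G p p.last, 1 - step G p p.last) ∈ pathIntervals G I p p.last := by
  simp [pathIntervals]

/-- The conventional intervals at the first and the last position account for the shifted values `0`
and `1 - lenPlus G p p.last`. -/
lemma shiftedCritical_add_mem {x : ℝ} (hx : x ∈ shiftedCritical G I p) {m : ℕ}
    (hm : m < p.last) : x + lenPlus G p m ∈ critical G I p m := by
  simp only [shiftedCritical, Finset.mem_union, Finset.mem_insert, Finset.mem_singleton,
    Finset.mem_biUnion, Finset.mem_range, Finset.mem_image] at hx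
  rcases hx with (rfl | rfl) | ⟨j, hj, ⟨J, hJ, rfl⟩ | ⟨J, hJ, rfl⟩⟩
  · simpa using end_mem_critical (m := m) (by omega : 0 < p.last) (first_mem_pathIntervals G I p)
  · obtain ⟨k, hk⟩ : ∃ k, p.last = k + 1 := ⟨p.last - 1, by omega⟩
    have h := last_mem_pathIntervals G I p
    rw [hk] at h
    convert start_mem_critical (m := m) (by omega : k < p.last) h using 1
    rw [hk, step_succ]
    ring
  · exact end_mem_critical hj (ivl_subset_pathIntervals hJ)
  · exact start_mem_critical hj (ivl_subset_pathIntervals hJ)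

lemma one_mem_critical_last (G : TaskGraph V) (I : IntervalMap V) (p : VSeq V) :
    1 ∈ critical G I p p.last := by
  rcases hk : p.last with _ | k
  · simp [critical, hk]
  · have h := last_mem_pathIntervals G I p
    rw [hk] at h
    convert start_mem_critical (m := k + 1) (by omega : k < p.last) h using 1
    rw [step_succ]
    ring

lemma one_mem_exitTimes_last (G : TaskGraph V) (I : IntervalMap V) (p : VSeq V) :
    1 ∈ exitTimes G I p p.last :=
  mem_exitTimes.2 ⟨one_mem_critical_last G I p, zero_le_one, le_rfl⟩

/-- Rounding a feasible choice of the first `n` exit times. -/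
lemma exists_rounding_path {n : ℕ} (hn : n ≤ p.last) {H cap : ℝ} {t : ℕ → ℝ}
    (ht : ∀ j < n, prevTime t j + step G p j ≤ t j) (hcap : ∀ j < n, t j ≤ cap + lenPlus G p j) :
    ∃ (s : ℕ → ℝ) (h : ℝ), 0 ≤ h ∧ (∀ j < n, prevTime s j + step G p j ≤ s j) ∧
      (∀ j < n, lenPlus G p j ≤ s j ∧ s j ≤ cap + lenPlus G p j ∧ s j ≤ t j + h ∧
        (s j ∈ critical G I p j ∨ s j = cap + lenPlus G p j)) ∧
      partialReward I p.vert t n + vertexReward I (p.vert n) (prevTime t n) H + h ≤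
        partialReward I p.vert s n + vertexReward I (p.vert n) (prevTime s n) H := by
  classical
  -- The cap need not be critical, so it is inserted by hand; the conclusion keeps it as a separate
  -- alternative.
  obtain ⟨σ, h, h1, h2, h3, h4⟩ := exists_rounding (I := I) (v := p.vert) (L := lenPlus G p)
    (H := H) (n := n) (insert cap (shiftedCritical G I p)) (cap := cap)
    (by simp [shiftedCritical]) (by simp)
    (fun j hj J hJ => Finset.mem_insert_of_mem (Finset.mem_union_right _ (Finset.mem_biUnion.2
      ⟨j, Finset.mem_range.2 (by omega), Finset.mem_union_left _
        (Finset.mem_image_of_mem (fun J : ℝ × ℝ => J.2 - lenPlus G p j) hJ)⟩)))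
    (fun j hj J hJ => Finset.mem_insert_of_mem (Finset.mem_union_right _ (Finset.mem_biUnion.2
      ⟨j, Finset.mem_range.2 (by omega), Finset.mem_union_right _
        (Finset.mem_image_of_mem (fun J : ℝ × ℝ => J.1 - lenPlus G p j) hJ)⟩)))
    (fun j => t j - lenPlus G p j)
    (fun i j hij hj => by
      have := le_of_steps ht hij hj
      linarith)
    (fun j hj => ⟨sub_nonneg.2 (lenPlus_le_of_steps ht hj), by linarith [hcap j hj]⟩)
  refine ⟨fun j => σ j + lenPlus G p j, h, h1, fun j hj => ?_, fun j hj => ?_, ?_⟩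
  · cases j with
    | zero => simpa using (h3 0 hj).1
    | succ j =>
      have := h2 j (j + 1) (by omega) hj
      simp only [prevTime_succ, step_succ]
      linarith
  · obtain ⟨a, b, c, e⟩ := h3 j hj
    refine ⟨by dsimp only; linarith, by dsimp only; linarith, by dsimp only; linarith, ?_⟩
    rcases Finset.mem_insert.1 c with c | c
    · exact Or.inr (congrArg (· + lenPlus G p j) c)
    · exact Or.inl (shiftedCritical_add_mem c (by omega))
  · simpa only [shiftReward, sub_add_cancel] using h4

/-- The OTP algorithm is optimal for the given path. -/
lemma le_otp (hp : IsPath G p) {t : ℕ → ℝ}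
    (ht : ∀ j < p.last, prevTime t j + step G p j ≤ t j)
    (ht1 : prevTime t p.last + step G p p.last ≤ 1) :
    partialReward I p.vert t p.last + vertexReward I p.endpoint (prevTime t p.last) 1 ≤
      otp G I p := by
  obtain ⟨s, h, h1, h2, h3, h4⟩ := exists_rounding_path (I := I) (H := 1)
    (cap := 1 - lenPlus G p p.last) le_rfl ht fun j hj => by
      obtain ⟨k, hk⟩ : ∃ k, p.last = k + 1 := ⟨p.last - 1, by omega⟩
      have h5 := le_of_steps ht (by omega : j ≤ k) (by omega)
      rw [hk, prevTime_succ, step_succ] at ht1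
      rw [hk]
      linarith
  have hs1 : prevTime s p.last + step G p p.last ≤ 1 := by
    rcases hk : p.last with _ | k
    · simpa [hk] using ht1
    · have := (h3 k (by omega)).2.1
      rw [hk] at this
      simp only [prevTime_succ, step_succ]
      linarith
  have hmem : ∀ j < p.last, s j ∈ exitTimes G I p j := fun j hj => by
    obtain ⟨a, b, -, c⟩ := h3 j hj
    refine mem_exitTimes.2 ⟨?_, (lenPlus_nonneg hp hj.le).trans a, ?_⟩
    · rcases c with c | c
      · exact c
      · rw [c]
        exact shiftedCritical_add_mem (by simp [shiftedCritical]) hj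
    · linarith [lenPlus_mono hp hj.le le_rfl]
  obtain ⟨r, hr, hle⟩ := exists_bestReward_of_exitTimes hmem h2 hs1
  have := (exists_mem_processVertex (pairwise_exitTimes _) (one_mem_exitTimes_last G I p) hr).2
  unfold otp VSeq.endpoint
  linarith

end Critical

/-! ### The upper bound for a path -/

/-- If `u` yields a positive reward, there is a last interval of `u` from which one is obtained. -/
lemma exists_last_rewarded {I : IntervalMap V} {u : V} {a b : ℝ} (h : 0 < vertexReward I u a b) :
    ∃ J ∈ I.ivl u, J.1 < b ∧ a < J.2 ∧ vertexReward I u a b ≤ vertexReward I u a J.2 := by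
  classical
  obtain ⟨J₀, hJ₀, hpos⟩ := Finset.exists_lt_of_sum_lt (s := I.ivl u) (f := fun _ => (0 : ℝ))
    (g := fun J => max 0 (min b J.2 - max a J.1)) (by simpa [vertexReward] using h)
  obtain ⟨J, hJ, hmax⟩ := ((I.ivl u).filter fun J => max a J.1 < min b J.2).exists_max_image
    (fun J => J.2) ⟨J₀, Finset.mem_filter.2 ⟨hJ₀, by simpa [and_and_and_comm] using hpos⟩⟩
  simp only [Finset.mem_filter] at hJ hmax
  refine ⟨J, hJ.1, ?_, ?_, Finset.sum_le_sum fun K hK => ?_⟩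
  · exact (le_max_right _ _).trans_lt (hJ.2.trans_le (min_le_left _ _))
  · exact (le_max_left _ _).trans_lt (hJ.2.trans_le (min_le_right _ _))
  · rcases lt_or_ge (max a K.1) (min b K.2) with h' | h'
    · have := hmax K ⟨hK, h'⟩
      rw [min_eq_right this]
      gcongr
      exact min_le_right _ _
    · rw [max_eq_left (by linarith)]
      exact le_max_left _ _

section UbPath

variable [Fintype V] {G : TaskGraph V} {I : IntervalMap V} {p : VSeq V}

lemma ubVertex_nonneg (G : TaskGraph V) (I : IntervalMap V) (u : V) (t : ℝ) :
    0 ≤ ubVertex G I u t :=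
  (Finset.le_fold_max _).2 (Or.inl le_rfl)

lemma ubVertex_le {u : V} {t t' : ℝ} (h : t ≤ t') :
    ubVertex G I u t' ≤ ubVertex G I u t := by
  refine (Finset.fold_max_le _).2 ⟨ubVertex_nonneg _ _ _ _, fun X hX =>
    (Finset.le_fold_max _).2 (Or.inr ⟨X, hX, ?_⟩)⟩
  gcongr

/-- Each loss term is 1-Lipschitz in `t`. This pays for the delay `h` introduced by rounding, which
gains at least `h` in reward. -/
lemma ubVertex_le_add {u : V} {t h : ℝ} (hh : 0 ≤ h) :
    ubVertex G I u t ≤ ubVertex G I u (t + h) + h := by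
  refine (Finset.fold_max_le _).2 ⟨add_nonneg (ubVertex_nonneg _ _ _ _) hh, fun X hX => ?_⟩
  have h1 : ubInterval G I X - max 0 (t + h + delta G u X.1 - X.2.1) ≤ ubVertex G I u (t + h) :=
    (Finset.le_fold_max _).2 (Or.inr ⟨X, hX, le_rfl⟩)
  have h2 : max 0 (t + h + delta G u X.1 - X.2.1) ≤ max 0 (t + delta G u X.1 - X.2.1) + h := by
    refine max_le (add_nonneg (le_max_left _ _) hh) ?_
    linarith [le_max_right 0 (t + delta G u X.1 - X.2.1)]
  linarith

lemma le_ubPath {i : ℕ} (hi : i ≤ p.last) {J : ℝ × ℝ} (hJ : J ∈ pathIntervals G I p i) {r : ℝ}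
    (hr : bestReward I (entryList G I p (fun _ => 0) i) (p.vert i) 0 J.2 = some r) :
    r + ubVertex G I p.endpoint (J.1 + lenBetween G p i p.last) ≤ ubPath G I p := by
  refine (Finset.le_fold_max _).2 (Or.inr ⟨i, Finset.mem_range.2 (by omega),
    (Finset.le_fold_max _).2 (Or.inr ⟨J, hJ, ?_⟩)⟩)
  rw [hr]

/-- The induction goes back to the last position with positive reward. There the last rewarded
interval `J` is used: leaving at `J.2` loses no reward, while `J.1` precedes the true exit, so the
bound taken from `J.1` is the larger one. If no position pays, the conventional interval at position
`0` is used. -/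
lemma partialReward_add_ubVertex_le (hp : IsPath G p) {i : ℕ} (hi : i ≤ p.last) {t : ℕ → ℝ}
    (ht : ∀ j < i + 1, prevTime t j + step G p j ≤ t j) :
    partialReward I p.vert t (i + 1) + ubVertex G I p.endpoint (t i + lenBetween G p i p.last) ≤
      ubPath G I p := by
  induction i generalizing t with
  | zero => ?_
  | succ i ih => ?_
  all_goals
    rw [partialReward_succ]
  · rcases (vertexReward_nonneg I (p.vert 0) (prevTime t 0) (t 0)).eq_or_lt with h0 | h0
    · obtain ⟨r, hr, hle⟩ := exists_bestReward_of_exitTimes (G := G) (I := I) (p := p)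
        (d := fun _ => 0) (t := t) (n := 0) (s := lenPlus G p 0) (by simp) (by simp)
        (by simpa using lenPlus_zero_nonneg hp)
      have h1 := le_ubPath hi (first_mem_pathIntervals G I p) hr
      have h2 := ht 0 (by omega)
      simp only [prevTime_zero, step_zero, zero_add] at h2
      have h3 : ubVertex G I p.endpoint (t 0 + lenBetween G p 0 p.last) ≤
          ubVertex G I p.endpoint (lenPlus G p 0 + lenBetween G p 0 p.last) :=
        ubVertex_le (by linarith)
      have h4 := vertexReward_nonneg I (p.vert 0) (prevTime t 0) (lenPlus G p 0)
      dsimp only at h1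
      linarith
    · obtain ⟨J, hJ, h1, h2, h3⟩ := exists_last_rewarded h0
      obtain ⟨r, hr, hle⟩ := exists_bestReward_of_exitTimes (G := G) (I := I) (p := p)
        (d := fun _ => 0) (t := t) (n := 0) (s := J.2) (by simp) (by simp)
        (by simpa using h2.le)
      have h4 := le_ubPath hi (ivl_subset_pathIntervals hJ) hr
      have h5 : ubVertex G I p.endpoint (t 0 + lenBetween G p 0 p.last) ≤
          ubVertex G I p.endpoint (J.1 + lenBetween G p 0 p.last) :=
        ubVertex_le (by linarith)
      linarith
  · have hti := ht (i + 1) (by omega)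
    simp only [prevTime_succ, step_succ] at hti
    rcases (vertexReward_nonneg I (p.vert (i + 1)) (prevTime t (i + 1)) (t (i + 1))).eq_or_lt
      with h0 | h0
    · have h1 := ih (by omega) fun j hj => ht j (by omega)
      have h2 : ubVertex G I p.endpoint (t (i + 1) + lenBetween G p (i + 1) p.last) ≤
          ubVertex G I p.endpoint (t i + lenBetween G p i p.last) :=
        ubVertex_le (by unfold lenBetween; linarith)
      linarith
    · obtain ⟨J, hJ, h1, h2, h3⟩ := exists_last_rewarded h0
      rw [prevTime_succ] at h2
      have ht' : ∀ j < i + 1, prevTime t j + step G p j ≤ t j := fun j hj => ht j (by omega)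
      -- The earlier exits are rounded as if the task ended at `J.2`, with the cap forcing the exit
      -- from position `i` to be no later than `J.2`.
      obtain ⟨s, h, hh, hs1, hs2, hs3⟩ := exists_rounding_path (I := I) (H := J.2)
        (cap := J.2 - lenPlus G p i) hi ht' fun j hj => by
          have := le_of_steps ht' (by omega : j ≤ i) (by omega)
          linarith
      have hsi := hs2 i (by omega)
      -- If the cap is reached, the rounded solution collects nothing at position `i + 1`, and the
      -- induction hypothesis for `s` suffices once the delay `h` is compensated.
      by_cases hc : s i = J.2
      · have h4 := ih (by omega) hs1
        rw [prevTime_succ, prevTime_succ, hc, vertexReward_eq_zero I _ le_rfl] at hs3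
        have h5 : ubVertex G I p.endpoint (t (i + 1) + lenBetween G p (i + 1) p.last) ≤
            ubVertex G I p.endpoint (t (i + 1) + lenBetween G p (i + 1) p.last + h) + h :=
          ubVertex_le_add hh
        have h6 : ubVertex G I p.endpoint (t (i + 1) + lenBetween G p (i + 1) p.last + h) ≤
            ubVertex G I p.endpoint (s i + lenBetween G p i p.last) :=
          ubVertex_le (by unfold lenBetween; linarith)
        rw [prevTime_succ] at h3 ⊢
        linarith
      -- Otherwise no exit sits at the cap, since by monotonicity position `i` would too; hence all
      -- rounded times are critical.
      · have hmem : ∀ j < i + 1, s j ∈ exitTimes G I p j := fun j hj => by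
          obtain ⟨a, b, -, c⟩ := hs2 j hj
          have h4 := le_of_steps hs1 (by omega : j ≤ i) (by omega)
          refine mem_exitTimes.2 ⟨c.resolve_right fun h' => hc ?_,
            (lenPlus_nonneg hp (by omega)).trans a, ?_⟩
          · linarith
          · have := lenPlus_mono hp (by omega : j ≤ i) (by omega)
            linarith [(I.mem_unit _ J hJ).2.2]
        -- The relaxed run is needed because leaving position `i + 1` at `J.2` may violate the true
        -- delay after `s i`.
        have hd : ∀ j < i + 1, prevTime s j + (fun _ : ℕ => (0 : ℝ)) j ≤ s j := fun j hj => by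
          have h4 := hs1 j hj
          have h5 : 0 ≤ step G p j := by
            cases j with
            | zero => exact lenPlus_zero_nonneg hp
            | succ j =>
              rw [step_succ]
              linarith [lenPlus_le_succ hp (by omega : j < p.last)]
          dsimp only
          linarith
        obtain ⟨r, hr, hle⟩ := exists_bestReward_of_exitTimes (s := J.2) hmem hd (by
          rw [prevTime_succ]
          linarith)
        have h4 := le_ubPath hi (ivl_subset_pathIntervals hJ) hr
        have h5 : ubVertex G I p.endpoint (t (i + 1) + lenBetween G p (i + 1) p.last) ≤
            ubVertex G I p.endpoint (J.1 + lenBetween G p (i + 1) p.last) :=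
          ubVertex_le (by linarith)
        linarith

end UbPath

/-! ### Distances -/

section Delta

variable {G : TaskGraph V} {q : VSeq V}

/-- The part of a path between two of its positions. -/
def VSeq.segment (q : VSeq V) (a b : ℕ) : VSeq V := ⟨b - a, fun i => q.vert (a + i)⟩

lemma isPath_segment (hq : IsPath G q) {a b : ℕ} (hb : b ≤ q.last) : IsPath G (q.segment a b) :=
  fun i hi => hq (a + i) (by simp only [VSeq.segment] at hi; omega)

lemma connected_of_le (hq : IsPath G q) {a b : ℕ} (hab : a ≤ b) (hb : b ≤ q.last) :
    Connected G (q.vert a) (q.vert b) :=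
  ⟨q.segment a b, isPath_segment hq hb, rfl, by
    simp only [VSeq.segment, VSeq.endpoint]
    rw [Nat.add_sub_cancel' hab]⟩

lemma lenTo_segment (G : TaskGraph V) (q : VSeq V) (a b i : ℕ) :
    lenTo G (q.segment a b) i = lenTo G q (a + i) - lenTo G q a := by
  induction i with
  | zero => simp
  | succ i ih =>
    rw [lenTo_succ, ih, ← add_assoc, lenTo_succ]
    simp only [VSeq.segment, add_assoc]
    ring

lemma lenMinus_sub_lenPlus_nonneg (hq : IsPath G q) :
    0 ≤ lenMinus G q q.last - lenPlus G q 0 := by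
  rcases hk : q.last with _ | k
  · simp [lenMinus, lenPlus, hk]
  · rw [lenMinus_succ (by omega)]
    linarith [lenPlus_mono hq k.zero_le (by omega)]

lemma delta_le {u v : V} (hq : IsPath G q) (hu : q.vert 0 = u) (hv : q.endpoint = v) :
    delta G u v ≤ lenMinus G q q.last - lenPlus G q 0 := by
  refine csInf_le ⟨0, ?_⟩ ⟨q, hq, hu, hv, rfl⟩
  rintro _ ⟨q', hq', -, -, rfl⟩
  exact lenMinus_sub_lenPlus_nonneg hq'

lemma delta_self_le (G : TaskGraph V) (u : V) : delta G u u ≤ 0 := by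
  refine (delta_le (isPath_single G u) rfl rfl).trans ?_
  simp [VSeq.single, lenMinus, lenPlus]

lemma delta_le_of_lt (hq : IsPath G q) {a b : ℕ} (hab : a ≤ b) (hb : b < q.last) :
    delta G (q.vert a) (q.vert (b + 1)) ≤ lenPlus G q b - lenPlus G q a := by
  have hlast : (q.segment a (b + 1)).last = (b - a) + 1 := by
    simp only [VSeq.segment]
    omega
  refine (delta_le (isPath_segment hq (a := a) hb) rfl ?_).trans ?_
  · simp only [VSeq.segment, VSeq.endpoint]
    congr 1
    omega
  · have h1 : b - a < (q.segment a (b + 1)).last := by omega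
    have h2 : 0 < (q.segment a (b + 1)).last := by omega
    rw [hlast, lenMinus_succ h1, lenPlus_of_lt h1, lenPlus_of_lt h2, lenPlus_of_lt hb, lenPlus_of_lt (by omega : a < q.last),
      lenTo_segment, lenTo_segment]
    simp only [VSeq.segment]
    rw [Nat.add_sub_cancel' hab, show a + (b - a + 1) = b + 1 by omega]
    simp only [add_zero, zero_add, sub_self]
    linarith

/-- The half edges omitted by `delta` match the conventions for times: `t a` is taken in the middle
of the edge leaving position `a`, `prevTime t b` in the middle of the edge entering position `b`. -/
lemma add_delta_le (hq : IsPath G q) {t : ℕ → ℝ} {n a b : ℕ} (hn : n ≤ q.last)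
    (ht : ∀ j < n, prevTime t j + step G q j ≤ t j) (hab : a < b) (hb : b ≤ n) :
    t a + delta G (q.vert a) (q.vert b) ≤ prevTime t b := by
  obtain ⟨c, rfl⟩ : ∃ c, b = c + 1 := ⟨b - 1, by omega⟩
  have h1 := delta_le_of_lt hq (by omega : a ≤ c) (by omega)
  have h2 := le_of_steps ht (by omega : a ≤ c) (by omega)
  rw [prevTime_succ]
  linarith

end Delta

/-! ### The upper bound for an interval -/

/-- Disjoint intervals within `[A, B]` have total length at most `B - A`. -/
lemma sum_length_le {ι : Type*} (F : Finset ι) (a b : ι → ℝ) {A B : ℝ} (hAB : A ≤ B)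
    (hab : ∀ i ∈ F, a i < b i) (hA : ∀ i ∈ F, A ≤ a i) (hB : ∀ i ∈ F, b i ≤ B)
    (hdisj : ∀ i ∈ F, ∀ j ∈ F, i ≠ j → b i ≤ a j ∨ b j ≤ a i) :
    ∑ i ∈ F, (b i - a i) ≤ B - A := by
  classical
  -- The interval with the latest start is split off; all others end before that start, which
  -- becomes the new `B`.
  induction F using Finset.induction_on_max_value a generalizing B with
  | empty => simpa using hAB
  | insert i F hi hmax ih =>
    have hF : ∀ j ∈ F, b j ≤ a i := fun j hj => by
      rcases hdisj j (by simp [hj]) i (by simp) (fun h => hi (h ▸ hj)) with h | h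
      · exact h
      · have := hab i (by simp)
        have := hmax j hj
        have := hab j (by simp [hj])
        linarith
    rw [Finset.sum_insert hi]
    have h1 := ih (hA i (by simp)) (fun j hj => hab j (by simp [hj]))
      (fun j hj => hA j (by simp [hj])) hF
      fun j hj k hk => hdisj j (by simp [hj]) k (by simp [hk])
    have := hB i (by simp)
    linarith

section UbInterval

variable [Fintype V] {G : TaskGraph V} {I : IntervalMap V}

lemma ubIter_zero_le (n : ℕ) (X : V × (ℝ × ℝ)) : X.2.2 - X.2.1 ≤ ubIter G I n X := by
  induction n with
  | zero => exact le_rfl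
  | succ n ih => exact (Finset.le_fold_max _).2 (Or.inl ih)

lemma le_ubIter_succ {n : ℕ} {X Y : V × (ℝ × ℝ)} (hY : Y ∈ allIntervals I)
    (h : Reachable G X Y) :
    (X.2.2 - X.2.1) + ubIter G I n Y - max 0 (X.2.2 + delta G X.1 Y.1 - Y.2.1) ≤
      ubIter G I (n + 1) X :=
  (Finset.le_fold_max _).2 (Or.inr ⟨Y, by simp [hY, h], le_rfl⟩)

/-- The total length of a chain of stays `[a i, b i]` in intervals `X i`, the first of which is
`X i₀`, is bounded by `ubIter` minus the loss at the start. -/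
lemma sum_length_le_ubIter {ι : Type*} (X : ι → V × (ℝ × ℝ)) (a b : ι → ℝ) (n : ℕ)
    (F : Finset ι) (S : Finset (V × (ℝ × ℝ))) (hS : S.card ≤ n + 1)
    (hXS : ∀ i ∈ F, X i ∈ S) (hX : ∀ i ∈ F, X i ∈ allIntervals I)
    (hab : ∀ i ∈ F, a i < b i) (ha : ∀ i ∈ F, (X i).2.1 ≤ a i) (hb : ∀ i ∈ F, b i ≤ (X i).2.2)
    (hdisj : ∀ i ∈ F, ∀ j ∈ F, i ≠ j → b i ≤ a j ∨ b j ≤ a i)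
    (hchain : ∀ i ∈ F, ∀ j ∈ F, b i ≤ a j →
      Connected G (X i).1 (X j).1 ∧ b i + delta G (X i).1 (X j).1 ≤ a j)
    {i₀ : ι} (hi₀ : i₀ ∈ F) (hmin : ∀ i ∈ F, a i₀ ≤ a i) :
    ∑ i ∈ F, (b i - a i) ≤ ubIter G I n (X i₀) - (a i₀ - (X i₀).2.1) := by
  classical
  induction n generalizing F S i₀ with
  | zero =>
    have hsame : ∀ i ∈ F, X i = X i₀ := fun i hi =>
      Finset.card_le_one.1 hS _ (hXS i hi) _ (hXS i₀ hi₀)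
    have h1 := sum_length_le F a b (A := a i₀) (B := (X i₀).2.2)
      ((hab i₀ hi₀).le.trans (hb i₀ hi₀)) hab hmin (fun i hi => hsame i hi ▸ hb i hi) hdisj
    simp only [ubIter]
    linarith
  | succ n ih =>
    -- Here `i₁` is the last stay in the first interval. Everything up to it, including stays in
    -- other intervals, fits disjointly between `a i₀` and `b i₁`. Later stays avoid `X i₀`, so `S`
    -- shrinks and one iteration per interval suffices.
    obtain ⟨i₁, hi₁, hmax⟩ := (F.filter fun i => X i = X i₀).exists_max_image a
      ⟨i₀, by simp [hi₀]⟩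
    simp only [Finset.mem_filter] at hi₁ hmax
    have hbefore : ∀ i ∈ F, a i ≤ a i₁ → b i ≤ b i₁ := fun i hi h => by
      by_cases hne : i = i₁
      · rw [hne]
      · rcases hdisj i hi i₁ hi₁.1 hne with h' | h' <;>
          linarith [hab i hi, hab i₁ hi₁.1]
    have hsplit := Finset.sum_filter_add_sum_filter_not F (fun i => a i ≤ a i₁)
      (fun i => b i - a i)
    have hhead := sum_length_le (F.filter fun i => a i ≤ a i₁) a b (A := a i₀) (B := b i₁)
      ((hmin i₁ hi₁.1).trans (hab i₁ hi₁.1).le)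
      (fun i hi => hab i (Finset.mem_filter.1 hi).1)
      (fun i hi => hmin i (Finset.mem_filter.1 hi).1)
      (fun i hi => hbefore i (Finset.mem_filter.1 hi).1 (Finset.mem_filter.1 hi).2)
      (fun i hi j hj => hdisj i (Finset.mem_filter.1 hi).1 j (Finset.mem_filter.1 hj).1)
    have hb₁ : b i₁ ≤ (X i₀).2.2 := hi₁.2 ▸ hb i₁ hi₁.1
    set F' := F.filter fun i => ¬ a i ≤ a i₁ with hF'
    rcases F'.eq_empty_or_nonempty with he | hne
    · rw [he, Finset.sum_empty, add_zero] at hsplit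
      have := ubIter_zero_le (G := G) (I := I) (n + 1) (X i₀)
      linarith
    · obtain ⟨i₂, hi₂, hmin₂⟩ := F'.exists_min_image a hne
      have hsub : ∀ i ∈ F', i ∈ F ∧ a i₁ < a i := fun i hi => by
        simpa [hF'] using hi
      have hi₂F := (hsub i₂ hi₂).1
      have htail := ih F' (S.erase (X i₀))
        (by
          rw [Finset.card_erase_of_mem (hXS i₀ hi₀)]
          omega)
        (fun i hi => Finset.mem_erase.2 ⟨fun h =>
          absurd (hmax i ⟨(hsub i hi).1, h⟩) (not_le.2 (hsub i hi).2), hXS i (hsub i hi).1⟩)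
        (fun i hi => hX i (hsub i hi).1) (fun i hi => hab i (hsub i hi).1)
        (fun i hi => ha i (hsub i hi).1) (fun i hi => hb i (hsub i hi).1)
        (fun i hi j hj => hdisj i (hsub i hi).1 j (hsub j hj).1)
        (fun i hi j hj => hchain i (hsub i hi).1 j (hsub j hj).1) hi₂ hmin₂
      have hlt := (hsub i₂ hi₂).2
      have h12 : b i₁ ≤ a i₂ := by
        rcases hdisj i₁ hi₁.1 i₂ hi₂F (fun h => by rw [h] at hlt; exact lt_irrefl _ hlt)
          with h | h
        · exact h
        · linarith [hab i₂ hi₂F, hab i₁ hi₁.1]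
      obtain ⟨hcon, hdel⟩ := hchain i₁ hi₁.1 i₂ hi₂F h12
      rw [hi₁.2] at hcon hdel
      have hstart : (X i₀).2.1 ≤ a i₁ := hi₁.2 ▸ ha i₁ hi₁.1
      have hub := le_ubIter_succ (n := n) (hX i₂ hi₂F)
        (⟨hcon, by linarith [hab i₁ hi₁.1, hab i₂ hi₂F, hb i₂ hi₂F]⟩ : Reachable G (X i₀) (X i₂))
      -- The travel penalty is covered by the unused end of `X i₀` and the missed start of `X i₂`.
      have hloss : max 0 ((X i₀).2.2 + delta G (X i₀).1 (X i₂).1 - (X i₂).2.1) ≤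
          (a i₂ - (X i₂).2.1) + ((X i₀).2.2 - b i₁) :=
        max_le (by linarith [ha i₂ hi₂F]) (by linarith)
      linarith

end UbInterval

/-! ### The upper bound for a path bounds all its extensions -/

section Rest

variable {G : TaskGraph V} {I : IntervalMap V} {p q : VSeq V}

lemma le_prevTime_of_steps (hq : IsPath G q) {t : ℕ → ℝ} {n a b : ℕ} (hn : n ≤ q.last)
    (ht : ∀ j < n, prevTime t j + step G q j ≤ t j) (hab : a < b) (hb : b ≤ n) :
    t a ≤ prevTime t b := by
  obtain ⟨c, rfl⟩ : ∃ c, b = c + 1 := ⟨b - 1, by omega⟩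
  have h1 := le_of_steps ht (by omega : a ≤ c) (by omega)
  have h2 := lenPlus_mono hq (by omega : a ≤ c) (by omega)
  rw [prevTime_succ]
  linarith

/-- A timing profile, completed by the end of the task. -/
lemma exists_complete_profile {t : ℕ → ℝ} (ht : IsTimingProfile G q t) :
    ∃ s : ℕ → ℝ, (∀ j < q.last + 1, prevTime s j + step G q j ≤ s j) ∧
      profileReward I q t = partialReward I q.vert s (q.last + 1) := by
  have hc : ∀ j < q.last, Function.update t q.last 1 j = t j := fun j hj =>
    Function.update_of_ne hj.ne _ _
  obtain ⟨h1, h2⟩ := isTimingProfile_iff.1 ht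
  refine ⟨Function.update t q.last 1, fun j hj => ?_, ?_⟩
  · rw [prevTime_congr fun i hi => hc i (by omega)]
    rcases Nat.lt_succ_iff_lt_or_eq.1 hj with h | rfl
    · rw [hc j h]
      exact h1 j h
    · rwa [Function.update_self]
  · rw [profileReward_eq, partialReward_succ, partialReward_congr (fun _ _ => rfl) hc,
      prevTime_congr hc, Function.update_self, VSeq.endpoint]

variable [Fintype V]

/-- The bound for a vertex bounds the reward after this vertex. -/
lemma sum_vertexReward_le_ubVertex (hq : IsPath G q) {t : ℕ → ℝ} {k : ℕ}
    (ht : ∀ j < q.last + 1, prevTime t j + step G q j ≤ t j) :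
    ∑ j ∈ Finset.Ico (k + 1) (q.last + 1), vertexReward I (q.vert j) (prevTime t j) (t j) ≤
      ubVertex G I (q.vert k) (t k) := by
  classical
  have ht' : ∀ j < q.last, prevTime t j + step G q j ≤ t j := fun j hj => ht j (by omega)
  -- Stays are indexed by position and interval, because a path may return to the same interval.
  let a : (_ : ℕ) × (ℝ × ℝ) → ℝ := fun i => max (prevTime t i.1) i.2.1
  let b : (_ : ℕ) × (ℝ × ℝ) → ℝ := fun i => min (t i.1) i.2.2
  let X : (_ : ℕ) × (ℝ × ℝ) → V × (ℝ × ℝ) := fun i => (q.vert i.1, i.2)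
  set F := ((Finset.Ico (k + 1) (q.last + 1)).sigma fun j => I.ivl (q.vert j)).filter
    fun i => a i < b i with hF
  have hsum : ∑ j ∈ Finset.Ico (k + 1) (q.last + 1),
      vertexReward I (q.vert j) (prevTime t j) (t j) = ∑ i ∈ F, (b i - a i) := by
    unfold vertexReward
    rw [Finset.sum_sigma', hF, Finset.sum_filter]
    refine Finset.sum_congr rfl fun i _ => ?_
    split_ifs with h
    · exact max_eq_right (sub_nonneg.2 h.le)
    · exact max_eq_left (sub_nonpos.2 (not_lt.1 h))
  rw [hsum]
  have hmem : ∀ i ∈ F, (k < i.1 ∧ i.1 ≤ q.last) ∧ i.2 ∈ I.ivl (q.vert i.1) ∧ a i < b i :=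
    fun i hi => by
      simp only [hF, Finset.mem_filter, Finset.mem_sigma, Finset.mem_Ico] at hi
      exact ⟨⟨by omega, by omega⟩, hi.1.2, hi.2⟩
  have hlt : ∀ i ∈ F, ∀ j ∈ F, i.1 < j.1 → b i ≤ a j := fun i hi j hj h =>
    ((min_le_left _ _).trans (le_prevTime_of_steps hq le_rfl ht' h (hmem j hj).1.2)).trans
      (le_max_left _ _)
  have ha : ∀ i ∈ F, i.2.1 ≤ a i := fun i _ => le_max_right _ _
  have hb : ∀ i ∈ F, b i ≤ i.2.2 := fun i _ => min_le_right _ _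
  rcases F.eq_empty_or_nonempty with he | hne
  · rw [he, Finset.sum_empty]
    exact ubVertex_nonneg _ _ _ _
  obtain ⟨i₀, hi₀, hmin⟩ := F.exists_min_image a hne
  have hX : ∀ i ∈ F, X i ∈ allIntervals I := fun i hi => by
    simp only [allIntervals, Finset.mem_biUnion, Finset.mem_image]
    exact ⟨q.vert i.1, Finset.mem_univ _, i.2, (hmem i hi).2.1, rfl⟩
  have key := sum_length_le_ubIter (G := G) (I := I) X a b (allIntervals I).card F
    (allIntervals I) (Nat.le_succ _) hX hX (fun i hi => (hmem i hi).2.2) ha hb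
    (by
      rintro ⟨i, J⟩ hi ⟨j, K⟩ hj hne
      rcases lt_trichotomy i j with h | h | h
      · exact Or.inl (hlt _ hi _ hj h)
      · subst h
        have hJK : J ≠ K := fun h => hne (by rw [h])
        have h1 := I.nonoverlap _ J (hmem _ hi).2.1 K (hmem _ hj).2.1 hJK
        have h2 := (ha _ hi).trans_lt ((hmem _ hi).2.2.trans_le (hb _ hi))
        have h3 := (ha _ hj).trans_lt ((hmem _ hj).2.2.trans_le (hb _ hj))
        dsimp only at h2 h3
        rcases min_le_iff.1 h1 with h | h <;> rcases le_max_iff.1 h with h | h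
        · linarith
        · exact Or.inl ((hb _ hi).trans (h.trans (ha _ hj)))
        · exact Or.inr ((hb _ hj).trans (h.trans (ha _ hi)))
        · linarith
      · exact Or.inr (hlt _ hj _ hi h))
    (by
      rintro ⟨i, J⟩ hi ⟨j, K⟩ hj hba
      rcases lt_trichotomy i j with h | h | h
      · have h1 := add_delta_le hq le_rfl ht' h (hmem _ hj).1.2
        refine ⟨connected_of_le hq h.le (hmem _ hj).1.2, ?_⟩
        have h2 : b ⟨i, J⟩ ≤ t i := min_le_left _ _
        have h3 : prevTime t j ≤ a ⟨j, K⟩ := le_max_left _ _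
        dsimp only [X]
        linarith
      · subst h
        refine ⟨connected_of_le hq le_rfl (hmem _ hj).1.2, ?_⟩
        have := delta_self_le G (q.vert i)
        dsimp only [X]
        linarith
      · have h1 := hlt _ hj _ hi h
        have h2 := (hmem _ hi).2.2
        have h3 := (hmem _ hj).2.2
        linarith)
    hi₀ hmin
  refine key.trans ((Finset.le_fold_max _).2 (Or.inr ⟨X i₀, ?_, ?_⟩))
  · rw [Finset.mem_filter]
    exact ⟨hX i₀ hi₀, connected_of_le hq (hmem i₀ hi₀).1.1.le (hmem i₀ hi₀).1.2⟩
  · have h1 := add_delta_le hq le_rfl ht' (hmem i₀ hi₀).1.1 (hmem i₀ hi₀).1.2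
    have h2 : max 0 (t k + delta G (q.vert k) (X i₀).1 - (X i₀).2.1) ≤ a i₀ - (X i₀).2.1 :=
      max_le (sub_nonneg.2 (ha i₀ hi₀)) (sub_le_sub_right (h1.trans (le_max_left _ _)) _)
    exact sub_le_sub_left h2 _

/-- The bound for a path bounds the rewards of all its extensions. -/
lemma profileReward_le_ubPath (hq : IsPath G q) (hpq : Extends p q) {t : ℕ → ℝ}
    (ht : IsTimingProfile G q t) : profileReward I q t ≤ ubPath G I p := by
  obtain ⟨s, hs, hr⟩ := exists_complete_profile (I := I) ht
  have h1 := partialReward_add_ubVertex_le (I := I) (hpq.isPath hq) le_rfl (t := s) fun j hj => by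
    have := hs j (by have := hpq.1; omega)
    have := hpq.step_le (G := G) hq (by omega : j ≤ p.last)
    linarith
  have h2 := sum_vertexReward_le_ubVertex (I := I) hq (k := p.last) hs
  have h3 : partialReward I q.vert s (p.last + 1) = partialReward I p.vert s (p.last + 1) :=
    partialReward_congr (fun j hj => hpq.2 j (by omega)) fun _ _ => rfl
  rw [hr, partialReward, ← Finset.sum_range_add_sum_Ico _ (by have := hpq.1; omega :
    p.last + 1 ≤ q.last + 1)]
  rw [hpq.2 _ le_rfl] at h2
  unfold partialReward at h3
  rw [h3]
  simp only [lenBetween, sub_self, add_zero] at h1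
  exact (add_le_add_right h2 _).trans h1

end Rest

/-! ### Correctness of branch and bound -/

lemma foldlM_option_induction {α β : Type*} {f : β → α → Option β} {P : β → Prop} {l : List α}
    {b c : β} (hb : P b) (h : l.foldlM f b = some c)
    (hf : ∀ a ∈ l, ∀ b c, P b → f b a = some c → P c) : P c := by
  induction l generalizing b with
  | nil =>
    simp only [List.foldlM_nil, pure, Option.some.injEq] at h
    exact h ▸ hb
  | cons a l ih =>
    simp only [List.foldlM_cons, Option.bind_eq_bind, Option.bind_eq_some_iff] at h
    obtain ⟨b', h1, h2⟩ := h
    exact ih (hf a (by simp) b b' hb h1) h2 fun a' ha' => hf a' (by simp [ha'])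

/-- The incumbent never decreases, so the value obtained from any one branch survives to the end of
the loop. -/
lemma foldlM_option_mem {α : Type*} {f : ℝ → α → Option ℝ} {l : List α} {b c : ℝ}
    (h : l.foldlM f b = some c) (hf : ∀ a ∈ l, ∀ b c, f b a = some c → b ≤ c) {a : α}
    (ha : a ∈ l) : ∃ x y, f x a = some y ∧ y ≤ c := by
  induction l generalizing b with
  | nil => simp at ha
  | cons a' l ih =>
    simp only [List.foldlM_cons, Option.bind_eq_bind, Option.bind_eq_some_iff] at h
    obtain ⟨b', h1, h2⟩ := h
    rcases List.mem_cons.1 ha with rfl | ha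
    · exact ⟨b, b', h1, foldlM_option_induction (P := fun y => b' ≤ y) le_rfl h2
        fun a' ha' b c hb hc => hb.trans (hf a' (by simp [ha']) b c hc)⟩
    · exact ih h2 (fun a' ha' => hf a' (by simp [ha'])) ha

lemma exists_foldlM_option {α β : Type*} {f : β → α → Option β} {l : List α} (b : β)
    (hf : ∀ a ∈ l, ∀ b, ∃ c, f b a = some c) : ∃ c, l.foldlM f b = some c := by
  induction l generalizing b with
  | nil => exact ⟨b, rfl⟩
  | cons a l ih =>
    obtain ⟨b', hb'⟩ := hf a (by simp) b
    obtain ⟨c, hc⟩ := ih b' fun a' ha' => hf a' (by simp [ha'])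
    exact ⟨c, by simp [List.foldlM_cons, hb', hc]⟩

section BranchAndBound

variable {G : TaskGraph V} {I : IntervalMap V} {nbr : V → List V}

lemma profileReward_le_otp {p q : VSeq V} (hq : IsPath G q) (hpq : Extends p q)
    (hlast : q.last = p.last) {t : ℕ → ℝ} (ht : IsTimingProfile G q t) :
    profileReward I q t ≤ otp G I p := by
  obtain ⟨h1, h2⟩ := isTimingProfile_iff.1 ht
  rw [hlast] at h1 h2
  have hstep := fun j (hj : j ≤ p.last) => hpq.step_le (G := G) hq hj
  refine le_trans (le_of_eq ?_) (le_otp (I := I) (hpq.isPath hq) (t := t)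
    (fun j hj => by linarith [h1 j hj, hstep j hj.le]) (by linarith [hstep _ le_rfl]))
  rw [profileReward_eq, hlast, VSeq.endpoint, hlast, hpq.2 _ le_rfl, VSeq.endpoint,
    partialReward_congr (fun j hj => hpq.2 j hj.le) fun _ _ => rfl]

/-- Paths that are too long have no feasible extension. -/
lemma lenPlus_last_le_one {p q : VSeq V} (hq : IsPath G q) (hpq : Extends p q) {t : ℕ → ℝ}
    (ht : IsTimingProfile G q t) : lenPlus G p p.last ≤ 1 := by
  rw [lenPlus_last, ← hpq.lenTo_eq le_rfl]
  refine (lenTo_mono hq hpq.1 le_rfl).trans ?_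
  obtain ⟨h1, h2⟩ := isTimingProfile_iff.1 ht
  rcases hk : q.last with _ | k
  · simp
  · have h3 := lenPlus_le_of_steps h1 (by omega : k < q.last)
    rw [hk, prevTime_succ, step_succ, ← hk, lenPlus_last, hk] at h2
    linarith

variable [Fintype V]

/-- The value of branch and bound does not exceed the rewards of the feasible solutions. -/
lemma branchAndBound_le (hnbr : ∀ u w, w ∈ nbr u → G.Adj u w) {v₀ : V} {n : ℕ} {p : VSeq V}
    (hp : IsPath G p) (hp0 : p.vert 0 = v₀) {Rmax R : ℝ}
    (hR : ∃ r ∈ optpRewards G I v₀, Rmax ≤ r)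
    (h : branchAndBound G I nbr n p Rmax = some R) : ∃ r ∈ optpRewards G I v₀, R ≤ r := by
  have hmax : ∀ {x y : ℝ}, (∃ r ∈ optpRewards G I v₀, x ≤ r) →
      (∃ r ∈ optpRewards G I v₀, y ≤ r) → ∃ r ∈ optpRewards G I v₀, max x y ≤ r := by
    rintro x y hx hy
    rcases max_cases x y with ⟨h, -⟩ | ⟨h, -⟩ <;> rw [h] <;> assumption
  induction n generalizing p Rmax R with
  | zero => simp [branchAndBound] at h
  | succ n ih =>
    have hinc := hmax hR (hp0 ▸ otp_le (I := I) hp)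
    rw [branchAndBound] at h
    split_ifs at h with hlen hub
    · obtain ⟨r, hr⟩ := optpRewards_nonempty G I v₀
      exact ⟨r, hr, Option.some.inj h ▸ optpRewards_nonneg hr⟩
    · exact Option.some.inj h ▸ hinc
    · refine foldlM_option_induction
        (P := fun x => ∃ r ∈ optpRewards G I v₀, x ≤ r) hinc h fun w hw b c hb hc => ?_
      obtain ⟨R', h', rfl⟩ := Option.map_eq_some_iff.1 hc
      exact hmax hb (ih (isPath_extend hp (hnbr _ _ hw)) ((extend_vert_zero p w).trans hp0) hb h')

/-- Branch and bound is at least as good as every extension of the given path. -/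
lemma profileReward_le_branchAndBound (hnbr : ∀ u w, G.Adj u w → w ∈ nbr u) {n : ℕ}
    {p : VSeq V} {Rmax R : ℝ} (h : branchAndBound G I nbr n p Rmax = some R) {q : VSeq V}
    (hq : IsPath G q) (hpq : Extends p q) {t : ℕ → ℝ} (ht : IsTimingProfile G q t) :
    profileReward I q t ≤ R := by
  induction n generalizing p Rmax R with
  | zero => simp [branchAndBound] at h
  | succ n ih =>
    -- The branch returning `0` cannot occur, as `p` has a feasible extension.
    rw [branchAndBound, if_neg (lenPlus_last_le_one hq hpq ht).not_gt] at h
    split_ifs at h with hub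
    · rw [← Option.some.inj h]
      exact (profileReward_le_ubPath hq hpq ht).trans hub
    · have hmono : ∀ w ∈ nbr p.endpoint, ∀ b c,
          (branchAndBound G I nbr n (p.extend w) b).map (fun R' => max b R') = some c →
          b ≤ c := fun w _ b c hc => by
        obtain ⟨R', -, rfl⟩ := Option.map_eq_some_iff.1 hc
        exact le_max_left _ _
      rcases hpq.single_or_extend hq with hlast | ⟨w, hw, hext⟩
      · exact (profileReward_le_otp hq hpq hlast ht).trans (foldlM_option_induction
          (P := fun x => otp G I p ≤ x) (le_max_right _ _) h
          fun w hw b c hb hc => hb.trans (hmono w hw b c hc))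
      · obtain ⟨x, y, h1, h2⟩ := foldlM_option_mem h hmono (hnbr _ _ hw)
        obtain ⟨R', h3, rfl⟩ := Option.map_eq_some_iff.1 h1
        exact ((ih h3 hext).trans (le_max_right _ _)).trans h2

end BranchAndBound

/-! ### Termination -/

section Termination

variable {G : TaskGraph V} {I : IntervalMap V} {nbr : V → List V}

lemma lenTo_lt_of_vert_eq (hG : PositiveCycles G) {p : VSeq V} (hp : IsPath G p) {i j : ℕ}
    (hij : i < j) (hj : j ≤ p.last) (h : p.vert i = p.vert j) : lenTo G p i < lenTo G p j := by
  have h1 := hG (p.segment i j) (isPath_segment hp hj) (by simp [VSeq.segment, hij])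
    (by simp [VSeq.segment, VSeq.endpoint, h, Nat.add_sub_cancel' hij.le])
  rw [lenTo_segment] at h1
  simp only [VSeq.segment, Nat.add_sub_cancel' hij.le] at h1
  linarith

variable [Fintype V]

/-- By the pigeonhole principle, two of the `card V + 1` positions carry the same vertex and enclose
a closed path. -/
lemma lenTo_lt_add_card (hG : PositiveCycles G) {p : VSeq V} (hp : IsPath G p) {i : ℕ}
    (hi : i + Fintype.card V ≤ p.last) : lenTo G p i < lenTo G p (i + Fintype.card V) := by
  obtain ⟨x, y, hxy, h⟩ := Fintype.exists_ne_map_eq_of_card_lt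
    (fun j : Fin (Fintype.card V + 1) => p.vert (i + j)) (by simp)
  wlog hlt : x < y generalizing x y
  · exact this y x hxy.symm h.symm (lt_of_le_of_ne (not_lt.1 hlt) hxy.symm)
  have hy := y.isLt
  have hlt' : (x : ℕ) < y := hlt
  calc lenTo G p i ≤ lenTo G p (i + x) := lenTo_mono hp (by omega) (by omega)
    _ < lenTo G p (i + y) := lenTo_lt_of_vert_eq hG hp (by omega) (by omega) h
    _ ≤ lenTo G p (i + Fintype.card V) := lenTo_mono hp (by omega) hi

/-- As many consecutive edges as there are vertices have a length that is bounded away from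
zero. -/
lemma exists_pos_le_lenTo (hG : PositiveCycles G) :
    ∃ ε > 0, ∀ p, IsPath G p → ∀ i, i + Fintype.card V ≤ p.last →
      lenTo G p i + ε ≤ lenTo G p (i + Fintype.card V) := by
  classical
  let len : (Fin (Fintype.card V + 1) → V) → ℝ := fun w =>
    ∑ j : Fin (Fintype.card V), G.len (w j.castSucc) (w j.succ)
  -- All vertex tuples are admitted, whether paths or not, hence the filter for positivity; the
  -- inserted `1` keeps the finite set nonempty.
  obtain ⟨ε, hε, hmin⟩ := (insert 1 ((Finset.univ.image len).filter (0 < ·))).exists_min_image id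
    ⟨1, by simp⟩
  refine ⟨ε, ?_, fun p hp i hi => ?_⟩
  · rcases Finset.mem_insert.1 hε with rfl | h
    · exact one_pos
    · exact (Finset.mem_filter.1 h).2
  · have h1 := lenTo_lt_add_card hG hp hi
    have h2 : len (fun j => p.vert (i + j)) = lenTo G p (i + Fintype.card V) - lenTo G p i := by
      rw [← lenTo_segment G p i (i + Fintype.card V), lenTo, Finset.sum_range]
      rfl
    have h3 := hmin (len fun j => p.vert (i + j)) (Finset.mem_insert_of_mem (Finset.mem_filter.2
      ⟨Finset.mem_image_of_mem _ (Finset.mem_univ _), by rw [h2]; linarith⟩))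
    simp only [id, h2] at h3
    linarith

lemma exists_one_lt_lenTo (hG : PositiveCycles G) :
    ∃ K, ∀ p, IsPath G p → K ≤ p.last → 1 < lenTo G p p.last := by
  obtain ⟨ε, hε, h⟩ := exists_pos_le_lenTo hG
  obtain ⟨m, hm⟩ := exists_nat_gt (1 / ε)
  refine ⟨m * Fintype.card V, fun p hp hK => ?_⟩
  have key : ∀ n ≤ m, n * ε ≤ lenTo G p (n * Fintype.card V) := by
    intro n hn
    induction n with
    | zero => simp
    | succ n ih =>
      have h1 := Nat.mul_le_mul_right (Fintype.card V) hn
      rw [Nat.succ_mul] at h1 ⊢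
      have h2 := h p hp (n * Fintype.card V) (h1.trans hK)
      push_cast
      linarith [ih (by omega)]
  have h1 := key m le_rfl
  have h2 := lenTo_mono hp hK le_rfl
  rw [div_lt_iff₀ hε] at hm
  linarith

lemma branchAndBound_terminates (hnbr : ∀ u w, w ∈ nbr u → G.Adj u w) {K : ℕ}
    (hK : ∀ p, IsPath G p → K ≤ p.last → 1 < lenTo G p p.last) (d : ℕ) {p : VSeq V}
    (hp : IsPath G p) (hd : K ≤ p.last + d) (Rmax : ℝ) :
    ∃ R, branchAndBound G I nbr (d + 1) p Rmax = some R := by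
  induction d generalizing p Rmax with
  | zero =>
    rw [branchAndBound, if_pos (by
      rw [lenPlus_last]
      exact hK p hp hd)]
    exact ⟨0, rfl⟩
  | succ d ih =>
    rw [branchAndBound]
    split_ifs
    · exact ⟨_, rfl⟩
    · exact ⟨_, rfl⟩
    · refine exists_foldlM_option _ fun w hw b => ?_
      obtain ⟨R, hR⟩ := ih (isPath_extend hp (hnbr _ _ hw)) (by
        simp only [VSeq.extend]
        omega) b
      exact ⟨max b R, by rw [hR]; rfl⟩

end Termination

end GTAP

/-! ### Optimality and termination combined -/

theorem mainTheorem4 {V : Type*} [Fintype V] (G : GTAP.TaskGraph V) (I : GTAP.IntervalMap V)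
    (nbr : V → List V) (hnbr : ∀ u w, w ∈ nbr u ↔ G.Adj u w) (v₀ : V) :
    (∀ (n : ℕ) (R : ℝ),
      GTAP.branchAndBound G I nbr n (GTAP.VSeq.single v₀) 0 = some R →
        IsGreatest (GTAP.optpRewards G I v₀) R) ∧
    (GTAP.PositiveCycles G →
      ∃ (n : ℕ) (R : ℝ),
        GTAP.branchAndBound G I nbr n (GTAP.VSeq.single v₀) 0 = some R) := by
  refine ⟨fun n R h => ?_, fun hG => ?_⟩
  · have hub : R ∈ upperBounds (GTAP.optpRewards G I v₀) := by
      rintro _ ⟨q, t, hq, hq0, ht, rfl⟩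
      refine GTAP.profileReward_le_branchAndBound (fun u w => (hnbr u w).2) h hq
        ⟨Nat.zero_le _, fun i hi => ?_⟩ ht
      obtain rfl := Nat.le_zero.1 hi
      exact hq0
    obtain ⟨r₀, hr₀⟩ := GTAP.optpRewards_nonempty G I v₀
    obtain ⟨r, hr, hRr⟩ := GTAP.branchAndBound_le (fun u w => (hnbr u w).1)
      (GTAP.isPath_single G v₀) rfl ⟨r₀, hr₀, GTAP.optpRewards_nonneg hr₀⟩ h
    -- The value is only known to lie below some feasible reward `r`; the upper bound turns this
    -- into equality, which gives attainment.
    exact ⟨hRr.antisymm (hub hr) ▸ hr, hub⟩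
  · obtain ⟨K, hK⟩ := GTAP.exists_one_lt_lenTo hG
    obtain ⟨R, hR⟩ := GTAP.branchAndBound_terminates (I := I) (fun u w => (hnbr u w).1) hK K
      (GTAP.isPath_single G v₀) (Nat.le_add_left _ _) 0
    exact ⟨K + 1, R, hR⟩
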